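/- Let $(V,\otimes,k)$ be a commutative quantale, that is, a complete lattice with a commutative monoid structure whose multiplication preserves suprema in each variable. Let $P_V$ be the $V$-powerset monad on $\mathtt{Set}$: $P_V(X)=V^X$, $P_V(f)(\varphi)(y)=\bigvee_{f(x)=y}\varphi(x)$, with unit $x\mapsto\Delta_X(x,-)$ (value $k$ at $x$ and $\bot$ elsewhere) and multiplication $\Phi\mapsto\bigl(x\mapsto\bigvee_{\varphi\in V^X}\Phi(\varphi)\otimes\varphi(x)\bigr)$. Its category of Eilenberg–Moore algebras $\mathtt{Set}^{P_V}$ is monoidal, with the tensor product $\otimes_{P_V}$ that classifies bimorphisms (functions $X\times Y\to Z$ that are algebra morphisms in each variable separately) and with unit $V=P_V(1)$. Let $L$ be the list monad, with unit $e$ and multiplication $m$, extended to $V$-relations by $Lr(\underline x,\underline y)=r(x_1,y_1)\otimes\cdots\otimes r(x_n,y_n)$ for lists of equal length and $\bot$ otherwise; for $V$-relations $r:LX\times Y\to V$ and $s:LY\times Z\to V$ put $s\bullet r=s\circ Lr\circ m_X^\circ$. An $(L,V)$-category is a set $X$ with $a:LX\times X\to V$ such that $e_X^\circ\le a$ and $a\bullet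 a\le a$; an $(L,V)$-functor $f:(X,a)\to(Y,b)$ is a map with $a(\underline x,x)\le b(Lf(\underline x),f(x))$, and for $(L,V)$-functors $f\le g$ means $k\le\bigwedge_x b((f(x)),g(x))$. A distributor $(X,a)\rightharpoonup(Y,b)$ is a relation $j:LX\times Y\to V$ with $j\bullet a\le j$ and $b\bullet j\le j$. The presheaf category $\mathbb D_L(X)$ consists of the distributors from $X$ to the one-point $(L,V)$-category $(1,e_1^\circ)$, with structure $$[(f_1,\dots,f_n),g]=\bigwedge_{\underline x_1,\dots,\underline x_n\in LX}[f_1(\underline x_1)\otimes\cdots\otimes f_n(\underline x_n),\,g(\underline x_1;\dots;\underline x_n)].$$ $X$ is separated if, for all $(L,V)$-functors $f,g$ into $X$ with a common domain, $f\le g\le f$ implies $f=g$; it is cocomplete if its Yoneda embedding $X\to\mathbb D_L(X)$, $x\mapsto a(-,x)$, has a left adjoint $\mathtt{Sup}_X$. An $(L,V)$-functor $f:(X,a)\to(Y,b)$ between cocomplete $(L,V)$-categories is cocontinuous if $f\cdot\mathtt{Sup}_X\simeq\mathtt{Sup}_Y\cdot\mathbb D_L(f)$, where $\mathbb D_L(f)(\varphi)=\varphi\bullet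 f^{\circledast}$ and $f^{\circledast}(\underline y,x)=b(\underline y,f(x))$. Let $\mathtt{Inj}(V)$ be the category of cocomplete separated $(L,V)$-categories and cocontinuous $(L,V)$-functors. Then there is an equivalence of categories $$\mathtt{Mon}(\mathtt{Set}^{P_V},\otimes_{P_V},V)\;\simeq\;\mathtt{Inj}(V),$$ which commutes, up to natural isomorphism, with the forgetful functors to $\mathtt{Set}$. -/

import Mathlib

open CategoryTheory

universe u

namespace QuantMulti

set_option linter.unusedSectionVars false

noncomputable section

section Pow

theorem fun_ext' {X Y : Type u} {f g : X ⟶ Y} (h : ∀ x, f x = g x) : f = g := by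
  ext x
  exact h x

variable {V : Type u} [CommMonoid V] [CompleteLattice V] [IsQuantale V]

open Classical in
/-- The diagonal `V`-relation. -/
def diag {X : Type u} (x x' : X) : V := if x = x' then 1 else ⊥

/-- The direct image `P_V(f)`. -/
def pmap {X Y : Type u} (f : X → Y) (φ : X → V) : Y → V :=
  fun y => ⨆ (x : X) (_ : f x = y), φ x

/-- The multiplication `n_X` of the `V`-powerset monad. -/
def pmul {X : Type u} (Φ : (X → V) → V) : X → V :=
  fun x => ⨆ φ : X → V, Φ φ * φ x

theorem prop_iSup_mul (p : Prop) (a b : V) : (⨆ _ : p, a) * b = ⨆ _ : p, a * b := by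
  by_cases h : p <;> simp [h]

theorem mul_prop_iSup (p : Prop) (a b : V) : (b * ⨆ _ : p, a) = ⨆ _ : p, b * a := by
  by_cases h : p <;> simp [h]

theorem iSup_diag_mul {X : Type u} (x : X) (h : X → V) :
    ⨆ x', diag x x' * h x' = h x := by
  apply le_antisymm
  · refine iSup_le fun x' => ?_
    unfold diag
    split_ifs with e
    · subst e; simp
    · simp
  · refine le_trans ?_ (le_iSup _ x)
    simp [diag]

theorem iSup_mul_diag {X : Type u} (x : X) (h : X → V) :
    ⨆ x', h x' * diag x' x = h x := by
  apply le_antisymm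
  · refine iSup_le fun x' => ?_
    unfold diag
    split_ifs with e
    · subst e; simp
    · simp
  · refine le_trans ?_ (le_iSup _ x)
    simp [diag]

theorem iSup_pmap_mul {X Y : Type u} (f : X → Y) (φ : X → V) (h : Y → V) :
    ⨆ y, pmap f φ y * h y = ⨆ x, φ x * h (f x) := by
  simp only [pmap, Quantale.iSup_mul_distrib]
  rw [iSup_comm]
  refine iSup_congr fun x => ?_
  simp only [prop_iSup_mul]
  simp

theorem pmap_id {X : Type u} (φ : X → V) : pmap (fun x => x) φ = φ := by
  funext y; simp [pmap]

theorem pmap_pmap {X Y Z : Type u} (f : X → Y) (g : Y → Z) (φ : X → V) :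
    pmap g (pmap f φ) = pmap (fun x => g (f x)) φ := by
  funext z
  simp only [pmap]
  apply le_antisymm
  · refine iSup_le fun y => iSup_le fun hy => iSup_le fun x => iSup_le fun hx => ?_
    exact le_iSup₂_of_le x (by rw [hx, hy]) le_rfl
  · refine iSup_le fun x => iSup_le fun hx => ?_
    exact le_iSup₂_of_le (f x) hx (le_iSup₂_of_le x rfl le_rfl)

theorem pmap_diag {X Y : Type u} (f : X → Y) (x : X) :
    pmap f (diag x : X → V) = diag (f x) := by
  funext y
  have := iSup_pmap_mul f (diag x : X → V) (fun y' => diag y' y)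
  rw [iSup_mul_diag, iSup_diag_mul] at this
  exact this

theorem pmul_pmap_pmap {X Y : Type u} (f : X → Y) (Φ : (X → V) → V) :
    pmul (pmap (pmap f) Φ) = pmap f (pmul Φ) := by
  funext y
  simp only [pmul]
  rw [iSup_pmap_mul (pmap f) Φ (fun ψ => ψ y)]
  simp only [pmap, pmul, Quantale.mul_iSup_distrib]
  rw [iSup_comm]
  refine iSup_congr fun x => ?_
  rw [iSup_comm]
  simp only [mul_prop_iSup]

theorem pmul_pmap_pmul {X : Type u} (Φ : ((X → V) → V) → V) :
    pmul (pmap pmul Φ) = pmul (pmul Φ) := by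
  funext x
  simp only [pmul]
  rw [show (⨆ φ : X → V, pmap pmul Φ φ * φ x) = ⨆ Ψ, Φ Ψ * pmul Ψ x from
    iSup_pmap_mul pmul Φ (fun ψ => ψ x)]
  simp only [pmul, Quantale.mul_iSup_distrib, Quantale.iSup_mul_distrib]
  rw [iSup_comm]
  simp only [mul_assoc]

theorem pmul_diag {X : Type u} (φ : X → V) : pmul (diag φ) = φ := by
  funext x
  exact iSup_diag_mul φ (fun ψ => ψ x)

theorem pmul_pmap_diag {X : Type u} (φ : X → V) : pmul (pmap diag φ) = φ := by
  funext x
  simp only [pmul]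
  rw [iSup_pmap_mul diag φ (fun ψ => ψ x)]
  exact iSup_mul_diag x φ

variable (V) in
/-- The `V`-powerset monad `(P_V, u, n)` on the category of sets. -/
def powMonad : Monad (Type u) where
  obj X := X → V
  map f := ↾(pmap (V := V) f)
  map_id X := fun_ext' fun φ => pmap_id φ
  map_comp f g := fun_ext' fun φ => (pmap_pmap f g φ).symm
  η := { app := fun X => ↾(diag (V := V))
         naturality := fun X Y f => fun_ext' fun x => (pmap_diag f x).symm }
  μ := { app := fun X => ↾(pmul (V := V) (X := X))
         naturality := fun X Y f => fun_ext' fun Φ => pmul_pmap_pmap f Φ }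
  assoc X := fun_ext' fun Φ => pmul_pmap_pmul Φ
  left_unit X := fun_ext' fun φ => pmul_diag φ
  right_unit X := fun_ext' fun φ => pmul_pmap_diag φ

variable (V) in
/-- The Eilenberg-Moore category of `P_V`-algebras. -/
abbrev PowAlg : Type (u + 1) := (powMonad V).Algebra

/-- The structure map of a `P_V`-algebra, as a function. -/
def act (A : PowAlg V) (φ : A.A → V) : A.A := A.a φ

theorem act_diag (A : PowAlg V) (x : A.A) : act A (diag x) = x :=
  ConcreteCategory.congr_hom A.unit x

theorem act_pmul (A : PowAlg V) (Φ : (A.A → V) → V) :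
    act A (pmul Φ) = act A (pmap (act A) Φ) :=
  ConcreteCategory.congr_hom A.assoc Φ

theorem hom_act {A B : PowAlg V} (f : A ⟶ B) (φ : A.A → V) :
    f.f (act A φ) = act B (pmap f.f φ) :=
  (ConcreteCategory.congr_hom f.h φ).symm

/-- Build an algebra from functions. -/
def mkAlg (X : Type u) (α : (X → V) → X) (h₁ : ∀ x, α (diag x) = x)
    (h₂ : ∀ Φ, α (pmul Φ) = α (pmap α Φ)) : PowAlg V where
  A := X
  a := ↾α
  unit := fun_ext' fun x => h₁ x
  assoc := fun_ext' fun Φ => h₂ Φ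

/-- Build a morphism of algebras from a function. -/
def mkHom {A B : PowAlg V} (f : A.A → B.A) (h : ∀ φ, f (act A φ) = act B (pmap f φ)) : A ⟶ B where
  f := ↾f
  h := fun_ext' fun φ => (h φ).symm

theorem alg_hom_ext {A B : PowAlg V} {f g : A ⟶ B} (h : ∀ x, f.f x = g.f x) : f = g := by
  apply Monad.Algebra.Hom.ext'
  exact fun_ext' h


/-- The value of a formal `V`-weighted family under the structure map. -/
def wsum (A : PowAlg V) {I : Type u} (Φ : I → V) (g : I → A.A) : A.A := act A (pmap g Φ)

theorem wsum_diag (A : PowAlg V) {I : Type u} (i : I) (g : I → A.A) :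
    wsum A (diag i) g = g i := by
  rw [wsum, pmap_diag, act_diag]

theorem wsum_pmap (A : PowAlg V) {I J : Type u} (h : I → J) (Φ : I → V) (g : J → A.A) :
    wsum A (pmap h Φ) g = wsum A Φ (fun i => g (h i)) := by
  rw [wsum, wsum, pmap_pmap]

theorem wsum_wsum (A : PowAlg V) {I J : Type u} (Φ : I → V) (Ψ : I → J → V) (g : J → A.A) :
    wsum A Φ (fun i => wsum A (Ψ i) g) = wsum A (fun j => ⨆ i, Φ i * Ψ i j) g := by
  have h : (fun j => ⨆ i, Φ i * Ψ i j) = pmul (pmap Ψ Φ) := by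
    funext j
    exact (iSup_pmap_mul Ψ Φ (fun ψ => ψ j)).symm
  rw [h]
  simp only [wsum]
  rw [← pmul_pmap_pmap, act_pmul, pmap_pmap, pmap_pmap]

theorem wsum_comm (A : PowAlg V) {I J : Type u} (Φ : I → V) (Ψ : J → V) (f : I → J → A.A) :
    wsum A Φ (fun i => wsum A Ψ (f i)) = wsum A Ψ (fun j => wsum A Φ (fun i => f i j)) := by
  have h₁ : ∀ i, wsum A Ψ (f i) = wsum A (pmap (fun j => (i, j)) Ψ) (fun p : I × J => f p.1 p.2) :=
    fun i => (wsum_pmap A (fun j => (i, j)) Ψ (fun p : I × J => f p.1 p.2)).symm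
  have h₂ : ∀ j, wsum A Φ (fun i => f i j) =
      wsum A (pmap (fun i => (i, j)) Φ) (fun p : I × J => f p.1 p.2) :=
    fun j => (wsum_pmap A (fun i => (i, j)) Φ (fun p : I × J => f p.1 p.2)).symm
  simp only [h₁, h₂]
  rw [wsum_wsum, wsum_wsum]
  congr 1
  funext ⟨i, j⟩
  have e₁ : (⨆ i', Φ i' * pmap (fun j' => (i', j')) Ψ (i, j)) = Φ i * Ψ j := by
    apply le_antisymm
    · refine iSup_le fun i' => ?_
      simp only [pmap, Quantale.mul_iSup_distrib, mul_prop_iSup]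
      refine iSup_le fun j' => iSup_le fun e => ?_
      simp only [Prod.mk.injEq] at e
      rw [e.1, e.2]
    · refine le_iSup_of_le i ?_
      simp only [pmap, Quantale.mul_iSup_distrib, mul_prop_iSup]
      exact le_iSup₂_of_le j rfl le_rfl
  have e₂ : (⨆ j', Ψ j' * pmap (fun i' => (i', j')) Φ (i, j)) = Ψ j * Φ i := by
    apply le_antisymm
    · refine iSup_le fun i' => ?_
      simp only [pmap, Quantale.mul_iSup_distrib, mul_prop_iSup]
      refine iSup_le fun j' => iSup_le fun e => ?_
      simp only [Prod.mk.injEq] at e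
      rw [e.1, e.2]
    · refine le_iSup_of_le j ?_
      simp only [pmap, Quantale.mul_iSup_distrib, mul_prop_iSup]
      exact le_iSup₂_of_le i rfl le_rfl
  rw [e₁, e₂, mul_comm]

/-- A function between carriers that commutes with the structure maps. -/
def IsHomFun (A B : PowAlg V) (f : A.A → B.A) : Prop :=
  ∀ φ, f (act A φ) = act B (pmap f φ)

theorem IsHomFun.wsum {A B : PowAlg V} {f : A.A → B.A} (hf : IsHomFun A B f) {I : Type u}
    (Φ : I → V) (g : I → A.A) : f (wsum A Φ g) = QuantMulti.wsum B Φ (fun i => f (g i)) := by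
  rw [QuantMulti.wsum, hf, pmap_pmap]; rfl

theorem isHomFun_of_hom {A B : PowAlg V} (f : A ⟶ B) : IsHomFun A B f.f := hom_act f

theorem isHomFun_id (A : PowAlg V) : IsHomFun A A (fun x => x) := fun φ => by rw [pmap_id]

theorem IsHomFun.comp {A B C : PowAlg V} {g : B.A → C.A} {f : A.A → B.A}
    (hg : IsHomFun B C g) (hf : IsHomFun A B f) : IsHomFun A C (fun x => g (f x)) := fun φ => by
  rw [← pmap_pmap f g, ← hg, ← hf]

theorem act_eq_wsum (A : PowAlg V) (φ : A.A → V) : act A φ = wsum A φ (fun x => x) := by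
  rw [wsum, pmap_id]

theorem isHomFun_wsum {A B : PowAlg V} {I : Type u} (Φ : I → V) (g : I → A.A → B.A)
    (hg : ∀ i, IsHomFun A B (g i)) : IsHomFun A B (fun x => wsum B Φ (fun i => g i x)) := by
  intro φ
  simp only [act_eq_wsum A φ, (hg _).wsum]
  rw [wsum_comm]
  rfl

/-- A bimorphism of `P_V`-algebras: a morphism of algebras in each variable separately. -/
structure IsBimorphism (A B C : PowAlg V) (f : A.A → B.A → C.A) : Prop where
  /-- Fixing the first variable gives a morphism in the second one. -/
  fix_left : ∀ x, IsHomFun B C (fun y => f x y)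
  /-- Fixing the second variable gives a morphism in the first one. -/
  fix_right : ∀ y, IsHomFun A C (fun x => f x y)

/-- Two elements of the free algebra on `A × B` are identified when all bimorphisms out of `A × B`
(extended to the free algebra) identify them. -/
def tensorSetoid (A B : PowAlg V) : Setoid (A.A × B.A → V) where
  r Φ Ψ := ∀ (C : PowAlg V) (f : A.A → B.A → C.A), IsBimorphism A B C f →
    wsum C Φ (fun p => f p.1 p.2) = wsum C Ψ (fun p => f p.1 p.2)
  iseqv := ⟨fun _ _ _ _ => rfl, fun h C f hf => (h C f hf).symm,
    fun h h' C f hf => (h C f hf).trans (h' C f hf)⟩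

/-- The underlying set of the tensor product of `P_V`-algebras. -/
def TensorCarrier (A B : PowAlg V) : Type u := Quotient (tensorSetoid A B)

/-- The function out of the tensor product that a bimorphism induces. -/
def descend {A B C : PowAlg V} (f : A.A → B.A → C.A) (hf : IsBimorphism A B C f) :
    TensorCarrier A B → C.A :=
  Quotient.lift (fun Φ => wsum C Φ (fun p => f p.1 p.2)) (fun _ _ h => h C f hf)

theorem descend_inj {A B : PowAlg V} {t t' : TensorCarrier A B}
    (h : ∀ (C : PowAlg V) (f : A.A → B.A → C.A) (hf : IsBimorphism A B C f),
      descend f hf t = descend f hf t') : t = t' := by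
  induction t using Quotient.inductionOn with | _ Φ
  induction t' using Quotient.inductionOn with | _ Ψ
  exact Quotient.sound h

/-- The structure map of the tensor product, induced by the free algebra on `A × B`. -/
def tensorAct (A B : PowAlg V) (φ : TensorCarrier A B → V) : TensorCarrier A B :=
  Quotient.mk (tensorSetoid A B) (pmul (pmap Quotient.out φ))

theorem descend_tensorAct {A B C : PowAlg V} (f : A.A → B.A → C.A) (hf : IsBimorphism A B C f)
    (φ : TensorCarrier A B → V) :
    descend f hf (tensorAct A B φ) = act C (pmap (descend f hf) φ) := by
  have h : descend f hf = fun t => wsum C (Quotient.out t) (fun p => f p.1 p.2) := by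
    funext t
    conv_lhs => rw [← Quotient.out_eq t]
    rfl
  change wsum C (pmul (pmap Quotient.out φ)) (fun p => f p.1 p.2) = _
  rw [wsum, ← pmul_pmap_pmap, act_pmul, pmap_pmap, h]
  exact congrArg (act C) (pmap_pmap _ _ φ)

/-- The tensor product of `P_V`-algebras: the algebra that represents bimorphisms, see
`existsUnique_tlift`. -/
def tensorAlg (A B : PowAlg V) : PowAlg V :=
  mkAlg (TensorCarrier A B) (tensorAct A B)
    (fun t => descend_inj fun C f hf => by
      rw [descend_tensorAct, pmap_diag, act_diag])
    (fun Φ => descend_inj fun C f hf => by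
      rw [descend_tensorAct, descend_tensorAct, ← pmul_pmap_pmap, act_pmul, pmap_pmap, pmap_pmap]
      simp only [descend_tensorAct])

/-- The universal bimorphism. -/
def tmul {A B : PowAlg V} (x : A.A) (y : B.A) : (tensorAlg A B).A :=
  Quotient.mk (tensorSetoid A B) (diag (x, y))

/-- The morphism of algebras that a bimorphism induces. -/
def tlift {A B C : PowAlg V} (f : A.A → B.A → C.A) (hf : IsBimorphism A B C f) :
    tensorAlg A B ⟶ C :=
  mkHom (A := tensorAlg A B) (descend f hf) (descend_tensorAct f hf)

theorem tlift_tmul {A B C : PowAlg V} (f : A.A → B.A → C.A) (hf : IsBimorphism A B C f)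
    (x : A.A) (y : B.A) : (tlift f hf).f (tmul x y) = f x y :=
  wsum_diag C (x, y) _

theorem tlift_inj {A B : PowAlg V} {t t' : (tensorAlg A B).A}
    (h : ∀ (C : PowAlg V) (f : A.A → B.A → C.A) (hf : IsBimorphism A B C f),
      (tlift f hf).f t = (tlift f hf).f t') : t = t' :=
  descend_inj h

theorem isBimorphism_tmul (A B : PowAlg V) :
    IsBimorphism A B (tensorAlg A B) (fun x y => tmul x y) := by
  constructor
  · intro x ψ
    refine tlift_inj fun C f hf => ?_
    rw [hom_act, pmap_pmap, tlift_tmul]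
    simp only [tlift_tmul]
    exact hf.1 x ψ
  · intro y ψ
    refine tlift_inj fun C f hf => ?_
    rw [hom_act, pmap_pmap, tlift_tmul]
    simp only [tlift_tmul]
    exact hf.2 y ψ

theorem exists_wsum_tmul {A B : PowAlg V} (t : (tensorAlg A B).A) :
    ∃ Φ : A.A × B.A → V, t = wsum (tensorAlg A B) Φ (fun p => tmul p.1 p.2) := by
  obtain ⟨Φ, rfl⟩ := Quotient.exists_rep (s := tensorSetoid A B) t
  refine ⟨Φ, tlift_inj fun C f hf => ?_⟩
  rw [(isHomFun_of_hom (tlift f hf)).wsum]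
  simp only [tlift_tmul]
  rfl

theorem tensor_ext {A B C : PowAlg V} {g g' : tensorAlg A B ⟶ C}
    (h : ∀ x y, g.f (tmul x y) = g'.f (tmul x y)) : g = g' := by
  refine alg_hom_ext fun t => ?_
  obtain ⟨Φ, rfl⟩ := exists_wsum_tmul t
  rw [(isHomFun_of_hom g).wsum, (isHomFun_of_hom g').wsum]
  simp only [h]

theorem isHomFun_tensor_ext {A B C : PowAlg V} {g g' : (tensorAlg A B).A → C.A}
    (hg : IsHomFun _ _ g) (hg' : IsHomFun _ _ g')
    (h : ∀ x y, g (tmul x y) = g' (tmul x y)) (t : (tensorAlg A B).A) : g t = g' t := by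
  obtain ⟨Φ, rfl⟩ := exists_wsum_tmul t
  rw [hg.wsum, hg'.wsum]
  simp only [h]

/-- The tensor product classifies bimorphisms. -/
theorem existsUnique_tlift {A B C : PowAlg V} (f : A.A → B.A → C.A) (hf : IsBimorphism A B C f) :
    ∃! g : tensorAlg A B ⟶ C, ∀ x y, g.f (tmul x y) = f x y :=
  ⟨tlift f hf, tlift_tmul f hf, fun _ h => tensor_ext fun x y => by rw [h, tlift_tmul]⟩

/-- The tensor product of two morphisms. -/
def tensorMap {A B C D : PowAlg V} (f : A ⟶ C) (g : B ⟶ D) : tensorAlg A B ⟶ tensorAlg C D :=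
  tlift (fun x y => tmul (f.f x) (g.f y))
    ⟨fun _ => ((isBimorphism_tmul C D).1 _).comp (isHomFun_of_hom g),
      fun _ => ((isBimorphism_tmul C D).2 _).comp (isHomFun_of_hom f)⟩

theorem tensorMap_tmul {A B C D : PowAlg V} (f : A ⟶ C) (g : B ⟶ D) (x : A.A) (y : B.A) :
    (tensorMap f g).f (tmul x y) = tmul (f.f x) (g.f y) := tlift_tmul _ _ _ _

theorem isBimorphism_assocAux (A B C : PowAlg V) (z : C.A) :
    IsBimorphism A B (tensorAlg A (tensorAlg B C)) (fun x y => tmul x (tmul y z)) :=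
  ⟨fun _ => ((isBimorphism_tmul _ _).1 _).comp ((isBimorphism_tmul _ _).2 _),
    fun _ => (isBimorphism_tmul _ _).2 _⟩

theorem isBimorphism_assocInvAux (A B C : PowAlg V) (x : A.A) :
    IsBimorphism B C (tensorAlg (tensorAlg A B) C) (fun y z => tmul (tmul x y) z) :=
  ⟨fun _ => (isBimorphism_tmul _ _).1 _,
    fun _ => ((isBimorphism_tmul _ _).2 _).comp ((isBimorphism_tmul _ _).1 _)⟩

/-- `(x ⊗ y) ⊗ z ↦ x ⊗ (y ⊗ z)`. -/
def assocHom (A B C : PowAlg V) :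
    tensorAlg (tensorAlg A B) C ⟶ tensorAlg A (tensorAlg B C) :=
  tlift (fun t z => (tlift _ (isBimorphism_assocAux A B C z)).f t)
    ⟨fun t => by
      obtain ⟨Φ, rfl⟩ := exists_wsum_tmul t
      simp only [(isHomFun_of_hom _).wsum, tlift_tmul]
      exact isHomFun_wsum Φ (fun p z => tmul p.1 (tmul p.2 z)) fun p =>
        ((isBimorphism_tmul _ _).1 _).comp ((isBimorphism_tmul _ _).1 _),
     fun z => isHomFun_of_hom _⟩

theorem assocHom_tmul {A B C : PowAlg V} (x : A.A) (y : B.A) (z : C.A) :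
    (assocHom A B C).f (tmul (tmul x y) z) = tmul x (tmul y z) := by
  rw [assocHom, tlift_tmul, tlift_tmul]

/-- `x ⊗ (y ⊗ z) ↦ (x ⊗ y) ⊗ z`. -/
def assocInv (A B C : PowAlg V) :
    tensorAlg A (tensorAlg B C) ⟶ tensorAlg (tensorAlg A B) C :=
  tlift (fun x t => (tlift _ (isBimorphism_assocInvAux A B C x)).f t)
    ⟨fun x => isHomFun_of_hom _,
     fun t => by
      obtain ⟨Φ, rfl⟩ := exists_wsum_tmul t
      simp only [(isHomFun_of_hom _).wsum, tlift_tmul]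
      exact isHomFun_wsum Φ (fun p x => tmul (tmul x p.1) p.2) fun p =>
        ((isBimorphism_tmul _ _).2 _).comp ((isBimorphism_tmul _ _).2 _)⟩

theorem assocInv_tmul {A B C : PowAlg V} (x : A.A) (y : B.A) (z : C.A) :
    (assocInv A B C).f (tmul x (tmul y z)) = tmul (tmul x y) z := by
  rw [assocInv, tlift_tmul, tlift_tmul]

theorem tensor_ext₃ {A B C D : PowAlg V} {g g' : tensorAlg (tensorAlg A B) C ⟶ D}
    (h : ∀ x y z, g.f (tmul (tmul x y) z) = g'.f (tmul (tmul x y) z)) : g = g' :=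
  tensor_ext fun t z => isHomFun_tensor_ext
    ((isHomFun_of_hom g).comp ((isBimorphism_tmul _ _).2 z))
    ((isHomFun_of_hom g').comp ((isBimorphism_tmul _ _).2 z)) (fun x y => h x y z) t

theorem tensor_ext₃' {A B C D : PowAlg V} {g g' : tensorAlg A (tensorAlg B C) ⟶ D}
    (h : ∀ x y z, g.f (tmul x (tmul y z)) = g'.f (tmul x (tmul y z))) : g = g' :=
  tensor_ext fun x t => isHomFun_tensor_ext
    ((isHomFun_of_hom g).comp ((isBimorphism_tmul _ _).1 x))
    ((isHomFun_of_hom g').comp ((isBimorphism_tmul _ _).1 x)) (fun y z => h x y z) t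

theorem tensor_ext₄ {A B C D E : PowAlg V}
    {g g' : tensorAlg (tensorAlg (tensorAlg A B) C) D ⟶ E}
    (h : ∀ x y z w, g.f (tmul (tmul (tmul x y) z) w) = g'.f (tmul (tmul (tmul x y) z) w)) :
    g = g' :=
  tensor_ext₃ fun t z w => isHomFun_tensor_ext
    ((isHomFun_of_hom g).comp
      (((isBimorphism_tmul _ _).2 w).comp ((isBimorphism_tmul _ _).2 z)))
    ((isHomFun_of_hom g').comp
      (((isBimorphism_tmul _ _).2 w).comp ((isBimorphism_tmul _ _).2 z)))
    (fun x y => h x y z w) t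

theorem alg_comp_apply {A B C : PowAlg V} (f : A ⟶ B) (g : B ⟶ C) (x : A.A) :
    (f ≫ g).f x = g.f (f.f x) := rfl

theorem alg_id_apply {A : PowAlg V} (x : A.A) : (𝟙 A : A ⟶ A).f x = x := rfl

variable (V) in
/-- The unit object `V = P_V(1)`, the free algebra on one point. -/
def unitAlg : PowAlg V := (powMonad V).free.obj PUnit

variable (V) in
/-- The generator of the free algebra on one point. -/
def unitPt : (unitAlg V).A := (diag PUnit.unit : PUnit → V)

/-- The action `v • x` of `V = P_V(1)` on an algebra. -/
def smulAlg (A : PowAlg V) (v : (unitAlg V).A) (x : A.A) : A.A :=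
  wsum A (I := PUnit) v (fun _ => x)

theorem smulAlg_unitPt (A : PowAlg V) (x : A.A) : smulAlg A (unitPt V) x = x :=
  wsum_diag A PUnit.unit _

theorem isHomFun_smulAlg_left (A : PowAlg V) (x : A.A) :
    IsHomFun (unitAlg V) A (fun v => smulAlg A v x) := by
  intro φ
  exact (wsum_wsum A φ (fun v : PUnit → V => v) (fun _ => x)).symm

theorem isHomFun_smulAlg_right (A : PowAlg V) (v : (unitAlg V).A) :
    IsHomFun A A (fun x => smulAlg A v x) :=
  isHomFun_wsum (I := PUnit) v (fun _ x => x) fun _ => isHomFun_id A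

theorem smulAlg_unit (v : (unitAlg V).A) : smulAlg (unitAlg V) v (unitPt V) = v :=
  pmul_pmap_diag (X := PUnit) v

theorem IsHomFun.smulAlg {A B : PowAlg V} {f : A.A → B.A} (hf : IsHomFun A B f)
    (v : (unitAlg V).A) (x : A.A) : f (smulAlg A v x) = QuantMulti.smulAlg B v (f x) :=
  hf.wsum (I := PUnit) v _

theorem smul_tmul {A B : PowAlg V} (v : (unitAlg V).A) (x : A.A) (y : B.A) :
    tmul (smulAlg A v x) y = tmul x (smulAlg B v y) :=
  (((isBimorphism_tmul A B).2 y).smulAlg v x).trans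
    (((isBimorphism_tmul A B).1 x).smulAlg v y).symm

/-- The left unitor. -/
def leftUnitorAlg (A : PowAlg V) : tensorAlg (unitAlg V) A ≅ A where
  hom := tlift (smulAlg A) ⟨isHomFun_smulAlg_right A, isHomFun_smulAlg_left A⟩
  inv := mkHom (fun x => tmul (unitPt V) x) ((isBimorphism_tmul _ _).1 _)
  hom_inv_id := tensor_ext fun v x => by
    rw [alg_comp_apply, tlift_tmul, alg_id_apply]
    change tmul (unitPt V) (smulAlg A v x) = _
    rw [← smul_tmul, smulAlg_unit]
  inv_hom_id := alg_hom_ext fun x => by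
    rw [alg_comp_apply, alg_id_apply]
    exact (tlift_tmul _ _ _ _).trans (smulAlg_unitPt A x)

/-- The right unitor. -/
def rightUnitorAlg (A : PowAlg V) : tensorAlg A (unitAlg V) ≅ A where
  hom := tlift (fun x v => smulAlg A v x) ⟨isHomFun_smulAlg_left A, isHomFun_smulAlg_right A⟩
  inv := mkHom (fun x => tmul x (unitPt V)) ((isBimorphism_tmul _ _).2 _)
  hom_inv_id := tensor_ext fun x v => by
    rw [alg_comp_apply, tlift_tmul, alg_id_apply]
    change tmul (smulAlg A v x) (unitPt V) = _
    rw [smul_tmul, smulAlg_unit]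
  inv_hom_id := alg_hom_ext fun x => by
    rw [alg_comp_apply, alg_id_apply]
    exact (tlift_tmul _ _ _ _).trans (smulAlg_unitPt A x)

theorem leftUnitorAlg_tmul (A : PowAlg V) (v : (unitAlg V).A) (x : A.A) :
    (leftUnitorAlg A).hom.f (tmul v x) = smulAlg A v x := tlift_tmul _ _ _ _

theorem rightUnitorAlg_tmul (A : PowAlg V) (x : A.A) (v : (unitAlg V).A) :
    (rightUnitorAlg A).hom.f (tmul x v) = smulAlg A v x := tlift_tmul _ _ _ _

/-- The associator. -/
def associatorAlg (A B C : PowAlg V) :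
    tensorAlg (tensorAlg A B) C ≅ tensorAlg A (tensorAlg B C) where
  hom := assocHom A B C
  inv := assocInv A B C
  hom_inv_id := tensor_ext₃ fun x y z => by
    rw [alg_comp_apply, assocHom_tmul, assocInv_tmul, alg_id_apply]
  inv_hom_id := tensor_ext₃' fun x y z => by
    rw [alg_comp_apply, assocInv_tmul, assocHom_tmul, alg_id_apply]

instance : MonoidalCategoryStruct (PowAlg V) where
  tensorObj := tensorAlg
  whiskerLeft A _ _ f := tensorMap (𝟙 A) f
  whiskerRight f B := tensorMap f (𝟙 B)
  tensorHom := tensorMap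
  tensorUnit := unitAlg V
  associator := associatorAlg
  leftUnitor := leftUnitorAlg
  rightUnitor := rightUnitorAlg

/-- The monoidal category of `P_V`-algebras, with tensor product the one that classifies
bimorphisms and with unit `V = P_V(1)`. -/
instance : MonoidalCategory (PowAlg V) :=
  MonoidalCategory.ofTensorHom
    (id_tensorHom_id := fun A B => tensor_ext fun x y => tensorMap_tmul _ _ x y)
    (id_tensorHom := fun _ _ _ _ => rfl)
    (tensorHom_id := fun _ _ => rfl)
    (tensorHom_comp_tensorHom := fun f₁ f₂ g₁ g₂ => tensor_ext fun x y => by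
      change (tensorMap g₁ g₂).f ((tensorMap f₁ f₂).f (tmul x y)) =
        (tensorMap (f₁ ≫ g₁) (f₂ ≫ g₂)).f (tmul x y)
      simp only [tensorMap_tmul, alg_comp_apply])
    (associator_naturality := fun f₁ f₂ f₃ => tensor_ext₃ fun x y z => by
      change (assocHom _ _ _).f ((tensorMap (tensorMap f₁ f₂) f₃).f (tmul (tmul x y) z)) =
        (tensorMap f₁ (tensorMap f₂ f₃)).f ((assocHom _ _ _).f (tmul (tmul x y) z))
      simp only [tensorMap_tmul, assocHom_tmul])
    (leftUnitor_naturality := fun {A B} f => tensor_ext fun v x => by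
      change (leftUnitorAlg B).hom.f ((tensorMap (𝟙 (unitAlg V)) f).f (tmul v x)) =
        f.f ((leftUnitorAlg A).hom.f (tmul v x))
      rw [tensorMap_tmul, leftUnitorAlg_tmul, leftUnitorAlg_tmul, (isHomFun_of_hom f).smulAlg]
      rfl)
    (rightUnitor_naturality := fun {A B} f => tensor_ext fun x v => by
      change (rightUnitorAlg B).hom.f ((tensorMap f (𝟙 (unitAlg V))).f (tmul x v)) =
        f.f ((rightUnitorAlg A).hom.f (tmul x v))
      rw [tensorMap_tmul, rightUnitorAlg_tmul, rightUnitorAlg_tmul, (isHomFun_of_hom f).smulAlg]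
      rfl)
    (pentagon := fun A B C D => tensor_ext₄ fun x y z w => by
      change (tensorMap (𝟙 A) (assocHom B C D)).f ((assocHom A (tensorAlg B C) D).f
        ((tensorMap (assocHom A B C) (𝟙 D)).f (tmul (tmul (tmul x y) z) w))) =
        (assocHom A B (tensorAlg C D)).f ((assocHom (tensorAlg A B) C D).f
          (tmul (tmul (tmul x y) z) w))
      simp only [tensorMap_tmul, assocHom_tmul, alg_id_apply])
    (triangle := fun A B => tensor_ext₃ fun x v y => by
      change (tensorMap (𝟙 A) (leftUnitorAlg B).hom).f
        ((assocHom A (unitAlg V) B).f (tmul (tmul x v) y)) =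
        (tensorMap (rightUnitorAlg A).hom (𝟙 B)).f (tmul (tmul x v) y)
      simp only [tensorMap_tmul, assocHom_tmul, alg_id_apply]
      erw [leftUnitorAlg_tmul, rightUnitorAlg_tmul]
      exact (smul_tmul v x y).symm)

end Pow

section Multi

variable {V : Type u} [CommMonoid V] [CompleteLattice V] [IsQuantale V]

/-- The composite `s ∘ r` of `V`-relations. -/
def relComp {X Y Z : Type u} (s : Y → Z → V) (r : X → Y → V) : X → Z → V :=
  fun x z => ⨆ y, r x y * s y z

/-- A function seen as a `V`-relation. -/
def graph {X Y : Type u} (f : X → Y) : X → Y → V := fun x y => diag (f x) y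

/-- The converse `r°` of a `V`-relation. -/
def conv {X Y : Type u} (r : X → Y → V) : Y → X → V := fun y x => r x y

/-- The extension `L r` of the list monad to `V`-relations: `r(x₁,y₁) ⊗ ⋯ ⊗ r(xₙ,yₙ)` for lists of
the same length, and `⊥` otherwise. -/
def listRel {X Y : Type u} (r : X → Y → V) : List X → List Y → V
  | [], [] => 1
  | x :: xs, y :: ys => r x y * listRel r xs ys
  | [], _ :: _ => ⊥
  | _ :: _, [] => ⊥

/-- The Kleisli composite `s • r = s ∘ L r ∘ m°` of `(L,V)`-relations. -/
def bullet {X Y Z : Type u} (s : List Y → Z → V) (r : List X → Y → V) : List X → Z → V :=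
  relComp s (relComp (listRel r) (conv (graph (List.flatten (α := X)))))

variable (V) in
/-- The identity `(L,V)`-relation `e°`. -/
def lunit (X : Type u) : List X → X → V := conv (graph fun x => [x])

theorem mul_le_bullet {X Y Z : Type u} (s : List Y → Z → V) (r : List X → Y → V)
    (xss : List (List X)) (ys : List Y) (z : Z) :
    listRel r xss ys * s ys z ≤ bullet s r xss.flatten z := by
  refine le_iSup_of_le ys (mul_le_mul_left ?_ _)
  refine le_iSup_of_le xss ?_
  simp [conv, graph, diag]

theorem bullet_le_iff {X Y Z : Type u} {s : List Y → Z → V} {r : List X → Y → V}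
    {t : List X → Z → V} :
    bullet s r ≤ t ↔ ∀ xss ys z, listRel r xss ys * s ys z ≤ t xss.flatten z := by
  constructor
  · exact fun h xss ys z => (mul_le_bullet s r xss ys z).trans (h _ _)
  · intro h xs z
    simp only [bullet, relComp, Quantale.iSup_mul_distrib]
    refine iSup_le fun ys => iSup_le fun xss => ?_
    simp only [conv, graph, diag]
    split_ifs with e
    · rw [one_mul, ← e]
      exact h xss ys z
    · simp

theorem flatten_map_single {X : Type u} (xs : List X) : (xs.map fun x => [x]).flatten = xs := by
  induction xs with
  | nil => rfl
  | cons x xs ih => simpa using ih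

theorem listRel_mono {X Y : Type u} {r r' : X → Y → V} (h : ∀ x y, r x y ≤ r' x y)
    (xs : List X) (ys : List Y) : listRel r xs ys ≤ listRel r' xs ys := by
  induction xs generalizing ys with
  | nil => cases ys <;> simp [listRel]
  | cons x xs ih =>
    cases ys with
    | nil => simp [listRel]
    | cons y ys => exact mul_le_mul' (h x y) (ih ys)

theorem listRel_mul_le {X Y Z W : Type u} {r : X → Y → V} {s : Y → Z → V} {t : W → Z → V}
    {p : X → W} (h : ∀ x y z, r x y * s y z ≤ t (p x) z) (xs : List X) (ys : List Y)
    (zs : List Z) : listRel r xs ys * listRel s ys zs ≤ listRel t (xs.map p) zs := by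
  induction xs generalizing ys zs with
  | nil =>
    cases ys with
    | nil => cases zs <;> simp [listRel]
    | cons y ys => simp [listRel]
  | cons x xs ih =>
    cases ys with
    | nil => simp [listRel]
    | cons y ys =>
      cases zs with
      | nil => simp [listRel]
      | cons z zs =>
        simp only [listRel, List.map_cons]
        rw [mul_mul_mul_comm]
        exact mul_le_mul' (h x y z) (ih ys zs)

theorem listRel_append {X Y : Type u} (r : X → Y → V) (xs : List X) (ys zs : List Y) :
    listRel r xs (ys ++ zs) =
      listRel r (xs.take ys.length) ys * listRel r (xs.drop ys.length) zs := by
  induction ys generalizing xs with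
  | nil => simp [listRel]
  | cons y ys ih =>
    cases xs with
    | nil => simp [listRel]
    | cons x xs => simp [listRel, ih, mul_assoc]

theorem listRel_flatten {X Y : Type u} (r : X → Y → V) (xs : List X) (yss : List (List Y)) :
    listRel r xs yss.flatten = ⊥ ∨
      ∃ xss : List (List X), xss.flatten = xs ∧
        listRel r xs yss.flatten = listRel (listRel r) xss yss := by
  induction yss generalizing xs with
  | nil =>
    cases xs with
    | nil => exact Or.inr ⟨[], rfl, rfl⟩
    | cons x xs => exact Or.inl rfl
  | cons ys yss ih =>
    rw [List.flatten_cons, listRel_append]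
    rcases ih (xs.drop ys.length) with h | ⟨xss, h₁, h₂⟩
    · left; rw [h]; simp
    · right
      exact ⟨xs.take ys.length :: xss, by simp [h₁], by rw [h₂]; rfl⟩

theorem listRel_map_right {X Y Z : Type u} (r : X → Z → V) (f : Y → Z) (xs : List X)
    (ys : List Y) : listRel r xs (ys.map f) = listRel (fun x y => r x (f y)) xs ys := by
  induction xs generalizing ys with
  | nil => cases ys <;> simp [listRel]
  | cons x xs ih => cases ys <;> simp [listRel, ih]

theorem one_le_listRel_map {X Y : Type u} {r : X → Y → V} {f : Y → X}
    (h : ∀ y, 1 ≤ r (f y) y) (ys : List Y) : 1 ≤ listRel r (ys.map f) ys := by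
  induction ys with
  | nil => simp [listRel]
  | cons y ys ih => exact one_le_mul (h y) ih

theorem bullet_mono_right {X Y Z : Type u} (s : List Y → Z → V) {r r' : List X → Y → V}
    (h : r ≤ r') : bullet s r ≤ bullet s r' :=
  bullet_le_iff.2 fun xss ys z =>
    (mul_le_mul_left (listRel_mono (fun x y => h x y) xss ys) _).trans (mul_le_bullet s r' xss ys z)

theorem bullet_mono_left {X Y Z : Type u} {s s' : List Y → Z → V} (r : List X → Y → V)
    (h : s ≤ s') : bullet s r ≤ bullet s' r :=
  bullet_le_iff.2 fun xss ys z =>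
    (mul_le_mul_right (h ys z) _).trans (mul_le_bullet s' r xss ys z)

theorem bullet_bullet_le {X Y Z W : Type u} (t : List Z → W → V) (s : List Y → Z → V)
    (r : List X → Y → V) : bullet (bullet t s) r ≤ bullet t (bullet s r) := by
  refine bullet_le_iff.2 fun xss ys w => ?_
  rw [mul_comm, ← Quantale.leftMulResiduation_le_iff_mul_le]
  revert ys w
  suffices h : bullet t s ≤ fun ys w =>
      Quantale.leftMulResiduation (listRel r xss ys) (bullet t (bullet s r) xss.flatten w) from
    fun ys w => h ys w
  refine bullet_le_iff.2 fun yss zs w => ?_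
  rw [Quantale.leftMulResiduation_le_iff_mul_le]
  rcases listRel_flatten r xss yss with h | ⟨xsss, h₁, h₂⟩
  · rw [h]; simp
  · rw [h₂, ← h₁, mul_comm, ← mul_assoc]
    have h₃ : listRel (listRel r) xsss yss * listRel s yss zs ≤
        listRel (bullet s r) (xsss.map List.flatten) zs :=
      listRel_mul_le (p := List.flatten) (fun xss ys z => mul_le_bullet s r xss ys z) _ _ _
    refine (mul_le_mul_left h₃ _).trans ?_
    rw [List.flatten_flatten]
    exact mul_le_bullet t (bullet s r) _ _ _

theorem listRel_relComp_le {X Y Z : Type u} (s : Y → Z → V) (r : X → Y → V) (xs : List X)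
    (zs : List Z) : listRel (relComp s r) xs zs ≤ ⨆ ys, listRel r xs ys * listRel s ys zs := by
  induction xs generalizing zs with
  | nil =>
    cases zs with
    | nil => exact le_iSup_of_le [] (by simp [listRel])
    | cons z zs => simp [listRel]
  | cons x xs ih =>
    cases zs with
    | nil => simp [listRel]
    | cons z zs =>
      simp only [listRel]
      refine (mul_le_mul_right (ih zs) _).trans ?_
      simp only [relComp, Quantale.iSup_mul_distrib, Quantale.mul_iSup_distrib]
      refine iSup_le fun ys => iSup_le fun y => ?_
      refine le_iSup_of_le (y :: ys) ?_
      simp only [listRel]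
      rw [mul_mul_mul_comm]

theorem listRel_conv_graph_le {X Y : Type u} (f : Y → X) (xs : List X) (ys : List Y) :
    listRel (conv (graph f) : X → Y → V) xs ys ≤ diag (ys.map f) xs := by
  induction xs generalizing ys with
  | nil => cases ys <;> simp [listRel, diag]
  | cons x xs ih =>
    cases ys with
    | nil => simp [listRel]
    | cons y ys =>
      simp only [listRel]
      refine (mul_le_mul_right (ih ys) _).trans ?_
      simp only [conv, graph, diag, List.map_cons, List.cons.injEq]
      split_ifs <;> simp_all

theorem listRel_mul_append_le {X Y : Type u} (r : X → Y → V) (xs xs' : List X) (ys ys' : List Y) :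
    listRel r xs ys * listRel r xs' ys' ≤ listRel r (xs ++ xs') (ys ++ ys') := by
  induction xs generalizing ys with
  | nil => cases ys <;> simp [listRel]
  | cons x xs ih =>
    cases ys with
    | nil => simp [listRel]
    | cons y ys =>
      simp only [listRel, List.cons_append, mul_assoc]
      exact mul_le_mul_right (ih ys) _

theorem listRel_listRel_le {X Y : Type u} (r : X → Y → V) (xss : List (List X))
    (yss : List (List Y)) : listRel (listRel r) xss yss ≤ listRel r xss.flatten yss.flatten := by
  induction xss generalizing yss with
  | nil => cases yss <;> simp [listRel]
  | cons xs xss ih =>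
    cases yss with
    | nil => simp [listRel]
    | cons ys yss =>
      simp only [listRel, List.flatten_cons]
      exact (mul_le_mul_right (ih yss) _).trans (listRel_mul_append_le r _ _ _ _)

theorem le_bullet_bullet {X Y Z W : Type u} (t : List Z → W → V) (s : List Y → Z → V)
    (r : List X → Y → V) : bullet t (bullet s r) ≤ bullet (bullet t s) r := by
  refine bullet_le_iff.2 fun xss zs w => ?_
  rw [← Quantale.leftMulResiduation_le_iff_mul_le]
  refine (listRel_relComp_le _ _ _ _).trans (iSup_le fun yss => ?_)
  rw [Quantale.leftMulResiduation_le_iff_mul_le]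
  have h : listRel (relComp (listRel r) (conv (graph List.flatten))) xss yss ≤
      Quantale.leftMulResiduation (listRel s yss zs * t zs w)
        (bullet (bullet t s) r xss.flatten w) := by
    refine (listRel_relComp_le _ _ _ _).trans (iSup_le fun xsss => ?_)
    rw [Quantale.leftMulResiduation_le_iff_mul_le]
    refine (mul_le_mul_left (mul_le_mul_left (listRel_conv_graph_le _ _ _) _) _).trans ?_
    unfold diag
    split_ifs with e
    · subst e
      rw [one_mul, List.flatten_flatten.symm]
      refine (mul_le_mul' (listRel_listRel_le r xsss yss) (mul_le_bullet t s yss zs w)).trans ?_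
      exact mul_le_bullet (bullet t s) r _ _ _
    · simp
  rw [mul_assoc]
  exact Quantale.leftMulResiduation_le_iff_mul_le.1 h

theorem bullet_assoc {X Y Z W : Type u} (t : List Z → W → V) (s : List Y → Z → V)
    (r : List X → Y → V) : bullet (bullet t s) r = bullet t (bullet s r) :=
  le_antisymm (bullet_bullet_le t s r) (le_bullet_bullet t s r)

theorem lunit_bullet_le {X Y : Type u} (r : List X → Y → V) : bullet (lunit V Y) r ≤ r := by
  refine bullet_le_iff.2 fun xss ys y => ?_
  simp only [lunit, conv, graph, diag]
  split_ifs with e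
  · subst e
    match xss with
    | [] => simp [listRel]
    | [xs] => simp [listRel]
    | _ :: _ :: _ => simp [listRel]
  · simp

variable (V) in
/-- An `(L,V)`-category. -/
structure LVCat where
  /-- The underlying set. -/
  carrier : Type u
  /-- The structure `a : L X ⇸ X`. -/
  hom : List carrier → carrier → V
  lunit_le : lunit V carrier ≤ hom
  bullet_le : bullet hom hom ≤ hom

theorem LVCat.one_le_hom (X : LVCat V) (x : X.carrier) : 1 ≤ X.hom [x] x := by
  have := X.lunit_le [x] x
  simpa [lunit, conv, graph, diag] using this

theorem LVCat.hom_comp (X : LVCat V) (xss : List (List X.carrier)) (ys : List X.carrier)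
    (z : X.carrier) : listRel X.hom xss ys * X.hom ys z ≤ X.hom xss.flatten z :=
  bullet_le_iff.1 X.bullet_le xss ys z

/-- An `(L,V)`-functor. -/
@[ext]
structure LVFunctor (X Y : LVCat V) where
  /-- The underlying function. -/
  toFun : X.carrier → Y.carrier
  hom_le : ∀ xs x, X.hom xs x ≤ Y.hom (xs.map toFun) (toFun x)

/-- The identity `(L,V)`-functor. -/
def LVFunctor.id (X : LVCat V) : LVFunctor X X where
  toFun x := x
  hom_le xs x := by simp

/-- The composite `g · f` of `(L,V)`-functors. -/
def LVFunctor.comp {X Y Z : LVCat V} (g : LVFunctor Y Z) (f : LVFunctor X Y) : LVFunctor X Z where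
  toFun x := g.toFun (f.toFun x)
  hom_le xs x := by
    refine (f.hom_le xs x).trans ((g.hom_le _ _).trans ?_)
    rw [List.map_map]; rfl

/-- The order on `(L,V)`-functors. -/
def LVFunctor.LE {X Y : LVCat V} (f g : LVFunctor X Y) : Prop :=
  1 ≤ ⨅ x, Y.hom [f.toFun x] (g.toFun x)

/-- `l` is left adjoint to `r`. -/
def LVFunctor.IsAdjoint {X Y : LVCat V} (l : LVFunctor X Y) (r : LVFunctor Y X) : Prop :=
  (LVFunctor.id X).LE (r.comp l) ∧ (l.comp r).LE (LVFunctor.id Y)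

/-- An `(L,V)`-distributor. -/
@[ext]
structure LVDist (X Y : LVCat V) where
  /-- The underlying `(L,V)`-relation. -/
  rel : List X.carrier → Y.carrier → V
  bullet_left : bullet rel X.hom ≤ rel
  bullet_right : bullet Y.hom rel ≤ rel

variable (V) in
/-- The discrete `(L,V)`-category on a set. -/
def discreteLV (X : Type u) : LVCat V where
  carrier := X
  hom := lunit V X
  lunit_le := le_rfl
  bullet_le := lunit_bullet_le _

variable (V) in
/-- The one-point `(L,V)`-category `E = (1, e°)`. -/
abbrev pointLV : LVCat V := discreteLV V PUnit

/-- Presheaves on `X`: the distributors from `X` to `E`. -/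
abbrev Presheaf (X : LVCat V) : Type u := LVDist X (pointLV V)

/-- The value of a presheaf at a list. -/
def LVDist.val {X : LVCat V} (φ : Presheaf X) (xs : List X.carrier) : V := φ.rel xs PUnit.unit

theorem Presheaf.ext_val {X : LVCat V} {φ ψ : Presheaf X} (h : ∀ xs, φ.val xs = ψ.val xs) :
    φ = ψ :=
  LVDist.ext (funext fun xs => funext fun _ => h xs)

theorem Presheaf.val_closed {X : LVCat V} (φ : Presheaf X) (xss : List (List X.carrier))
    (ys : List X.carrier) : listRel X.hom xss ys * φ.val ys ≤ φ.val xss.flatten :=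
  bullet_le_iff.1 φ.bullet_left xss ys PUnit.unit

/-- The hom of the presheaf category: `[(f₁,…,fₙ), g]` is the infimum over all lists of lists
`(x₁,…,xₙ)` of `[f₁(x₁) ⊗ ⋯ ⊗ fₙ(xₙ), g(x₁;…;xₙ)]`. -/
def presheafHom {X : LVCat V} (fs : List (Presheaf X)) (g : Presheaf X) : V :=
  ⨅ (xss : List (List X.carrier)) (_ : xss.length = fs.length),
    Quantale.leftMulResiduation (List.zipWith (fun f xs => f.val xs) fs xss).prod
      (g.val xss.flatten)

theorem listRel_eq_prod {X Y : Type u} (r : X → Y → V) (xs : List X) (ys : List Y)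
    (h : xs.length = ys.length) :
    listRel r xs ys = (List.zipWith (fun y x => r x y) ys xs).prod := by
  induction xs generalizing ys with
  | nil => cases ys <;> simp_all [listRel]
  | cons x xs ih => cases ys <;> simp_all [listRel]

theorem listRel_eq_bot {X Y : Type u} (r : X → Y → V) (xs : List X) (ys : List Y)
    (h : xs.length ≠ ys.length) : listRel r xs ys = ⊥ := by
  induction xs generalizing ys with
  | nil => cases ys <;> simp_all [listRel]
  | cons x xs ih => cases ys <;> simp_all [listRel]

theorem le_presheafHom_iff {X : LVCat V} {v : V} {fs : List (Presheaf X)} {g : Presheaf X} :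
    v ≤ presheafHom fs g ↔ ∀ xss : List (List X.carrier),
      v * listRel (fun xs (f : Presheaf X) => f.val xs) xss fs ≤ g.val xss.flatten := by
  simp only [presheafHom, le_iInf_iff, Quantale.leftMulResiduation_le_iff_mul_le]
  refine forall_congr' fun xss => ?_
  by_cases h : xss.length = fs.length
  · rw [listRel_eq_prod _ _ _ h]; simp [h]
  · rw [listRel_eq_bot _ _ _ h]; simp [h]

/-- The presheaf `(L,V)`-category `D_L(X)`. -/
def presheafLV (X : LVCat V) : LVCat V where
  carrier := Presheaf X
  hom := presheafHom
  lunit_le := by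
    intro fs g
    simp only [lunit, conv, graph, diag]
    split_ifs with e
    · subst e
      refine le_presheafHom_iff.2 fun xss => ?_
      match xss with
      | [] => simp [listRel]
      | [xs] => simp [listRel]
      | _ :: _ :: _ => simp [listRel]
    · exact bot_le
  bullet_le := by
    refine bullet_le_iff.2 fun fss gs h => le_presheafHom_iff.2 fun xss => ?_
    rcases listRel_flatten (fun xs (f : Presheaf X) => f.val xs) xss fss with e | ⟨xsss, h₁, h₂⟩
    · rw [e]; simp
    · rw [h₂, ← h₁]
      have h₃ : listRel (listRel fun xs (f : Presheaf X) => f.val xs) xsss fss *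
          listRel presheafHom fss gs ≤
          listRel (fun xs (f : Presheaf X) => f.val xs) (xsss.map List.flatten) gs := by
        refine listRel_mul_le (p := List.flatten) (fun xss fs g => ?_) _ _ _
        rw [mul_comm]
        exact le_presheafHom_iff.1 le_rfl xss
      rw [mul_comm, ← mul_assoc]
      refine (mul_le_mul_left h₃ _).trans ?_
      rw [mul_comm, List.flatten_flatten]
      exact le_presheafHom_iff.1 le_rfl _

/-- The presheaf `a(-, x)`. -/
def yonedaObj (X : LVCat V) (x : X.carrier) : Presheaf X where
  rel xs _ := X.hom xs x
  bullet_left := bullet_le_iff.2 fun xss ys _ => X.hom_comp xss ys x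
  bullet_right := lunit_bullet_le _

/-- The Yoneda embedding. -/
def yonedaLV (X : LVCat V) : LVFunctor X (presheafLV X) where
  toFun := yonedaObj X
  hom_le xs x := by
    refine le_presheafHom_iff.2 fun xss => ?_
    rw [mul_comm]
    refine le_of_eq_of_le ?_ (X.hom_comp xss xs x)
    exact congrArg (· * X.hom xs x)
      (listRel_map_right (Z := Presheaf X) (fun xs f => f.val xs) (yonedaObj X) xss xs)

/-- The distributor `f^⊛ : Y ⇀ X`, `f^⊛(ys, x) = b(ys, f x)`. -/
def upperStar {X Y : LVCat V} (f : LVFunctor X Y) : LVDist Y X where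
  rel ys x := Y.hom ys (f.toFun x)
  bullet_left := bullet_le_iff.2 fun xss ys x => Y.hom_comp xss ys (f.toFun x)
  bullet_right := bullet_le_iff.2 fun yss xs x => by
    refine (mul_le_mul_right (f.hom_le xs x) _).trans ?_
    rw [← listRel_map_right]
    exact Y.hom_comp _ _ _

/-- The composite of distributors. -/
def LVDist.comp {X Y Z : LVCat V} (s : LVDist Y Z) (r : LVDist X Y) : LVDist X Z where
  rel := bullet s.rel r.rel
  bullet_left := (bullet_bullet_le _ _ _).trans (bullet_mono_right _ r.bullet_left)
  bullet_right := (le_bullet_bullet _ _ _).trans (bullet_mono_left _ s.bullet_right)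

/-- The function underlying `D_L(f)`, `φ ↦ φ • f^⊛`. -/
def presheafMap {X Y : LVCat V} (f : LVFunctor X Y) (φ : Presheaf X) : Presheaf Y :=
  φ.comp (upperStar f)

/-- Separated `(L,V)`-categories: `f ≃ g` implies `f = g`. -/
def LVCat.IsSeparated (X : LVCat V) : Prop :=
  ∀ (Y : LVCat V) (f g : LVFunctor Y X), f.LE g → g.LE f → f = g

/-- Cocomplete `(L,V)`-categories: the Yoneda embedding has a left adjoint `Sup`. -/
def LVCat.IsCocomplete (X : LVCat V) : Prop :=
  ∃ S : LVFunctor (presheafLV X) X, S.IsAdjoint (yonedaLV X)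

/-- The order on points, `x ≤ y` when `k ≤ a((x), y)`. -/
def LVCat.le (X : LVCat V) (x y : X.carrier) : Prop := 1 ≤ X.hom [x] y

/-- Cocontinuous `(L,V)`-functors: `f · Sup ≃ Sup · D_L(f)`. -/
def LVFunctor.IsCocontinuous {X Y : LVCat V} (f : LVFunctor X Y) : Prop :=
  ∀ (S : LVFunctor (presheafLV X) X) (T : LVFunctor (presheafLV Y) Y),
    S.IsAdjoint (yonedaLV X) → T.IsAdjoint (yonedaLV Y) → ∀ φ : Presheaf X,
      Y.le (f.toFun (S.toFun φ)) (T.toFun (presheafMap f φ)) ∧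
        Y.le (T.toFun (presheafMap f φ)) (f.toFun (S.toFun φ))

theorem LVFunctor.le_iff {X Y : LVCat V} {f g : LVFunctor X Y} :
    f.LE g ↔ ∀ x, Y.le (f.toFun x) (g.toFun x) := le_iInf_iff

theorem LVCat.le_refl (X : LVCat V) (x : X.carrier) : X.le x x := X.one_le_hom x

theorem LVCat.le_trans (X : LVCat V) {x y z : X.carrier} (h : X.le x y) (h' : X.le y z) :
    X.le x z := by
  have := X.hom_comp [[x]] [y] z
  simp only [listRel, mul_one, List.flatten_cons, List.flatten_nil, List.append_nil] at this
  exact (one_le_mul h h').trans this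

theorem LVFunctor.map_le {X Y : LVCat V} (f : LVFunctor X Y) {x y : X.carrier} (h : X.le x y) :
    Y.le (f.toFun x) (f.toFun y) :=
  _root_.le_trans h (f.hom_le [x] y)

/-- The functor that picks out a point. -/
def LVCat.pt (X : LVCat V) (x : X.carrier) : LVFunctor (pointLV V) X where
  toFun _ := x
  hom_le xs y := by
    change lunit V PUnit xs y ≤ _
    simp only [lunit, conv, graph, diag]
    split_ifs with e
    · subst e
      exact X.one_le_hom x
    · exact bot_le

theorem LVCat.IsSeparated.eq {X : LVCat V} (hX : X.IsSeparated) {x y : X.carrier}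
    (h : X.le x y) (h' : X.le y x) : x = y := by
  have := hX (pointLV V) (X.pt x) (X.pt y) (LVFunctor.le_iff.2 fun _ => h)
    (LVFunctor.le_iff.2 fun _ => h')
  exact congrArg (fun f => f.toFun PUnit.unit) this

theorem LVFunctor.IsAdjoint.le_of_isAdjoint {X : LVCat V} {S T : LVFunctor (presheafLV X) X}
    (hS : S.IsAdjoint (yonedaLV X)) (hT : T.IsAdjoint (yonedaLV X)) (φ : Presheaf X) :
    X.le (S.toFun φ) (T.toFun φ) :=
  X.le_trans (S.map_le (LVFunctor.le_iff.1 hT.1 φ)) (LVFunctor.le_iff.1 hS.2 _)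

theorem presheafMap_id (X : LVCat V) (φ : Presheaf X) :
    presheafMap (LVFunctor.id X) φ = φ := by
  apply LVDist.ext
  apply le_antisymm
  · exact φ.bullet_left
  · intro xs z
    have h := mul_le_bullet φ.rel (upperStar (LVFunctor.id X)).rel (xs.map fun x => [x]) xs z
    rw [flatten_map_single] at h
    refine _root_.le_trans ?_ h
    exact le_mul_of_one_le_left' (one_le_listRel_map (fun x => X.one_le_hom x) xs)

theorem presheafMap_comp {X Y Z : LVCat V} (f : LVFunctor X Y) (g : LVFunctor Y Z)
    (φ : Presheaf X) : presheafMap g (presheafMap f φ) = presheafMap (g.comp f) φ := by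
  apply LVDist.ext
  change bullet (bullet φ.rel (upperStar f).rel) (upperStar g).rel =
    bullet φ.rel (upperStar (g.comp f)).rel
  rw [bullet_assoc]
  congr 1
  apply le_antisymm
  · refine bullet_le_iff.2 fun zss ys x => ?_
    refine (mul_le_mul_right (g.hom_le ys (f.toFun x)) _).trans ?_
    rw [show listRel (upperStar g).rel zss ys = listRel Z.hom zss (ys.map g.toFun) from
      (listRel_map_right Z.hom g.toFun zss ys).symm]
    exact Z.hom_comp _ _ _
  · intro zs x
    have h := mul_le_bullet (upperStar f).rel (upperStar g).rel [zs] [f.toFun x] x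
    simp only [listRel, mul_one, List.flatten_cons, List.flatten_nil, List.append_nil] at h
    refine _root_.le_trans ?_ h
    exact le_mul_of_one_le_right' (Y.one_le_hom _)

theorem LVFunctor.isCocontinuous_id {X : LVCat V} : (LVFunctor.id X).IsCocontinuous := by
  intro S T hS hT φ
  rw [presheafMap_id]
  exact ⟨hS.le_of_isAdjoint hT φ, hT.le_of_isAdjoint hS φ⟩

theorem LVFunctor.IsCocontinuous.comp {X Y Z : LVCat V} {f : LVFunctor X Y} {g : LVFunctor Y Z}
    (hg : g.IsCocontinuous) (hf : f.IsCocontinuous) (hY : Y.IsCocomplete) :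
    (g.comp f).IsCocontinuous := by
  intro S T hS hT φ
  obtain ⟨R, hR⟩ := hY
  have h₁ := hf S R hS hR φ
  have h₂ := hg R T hR hT (presheafMap f φ)
  rw [presheafMap_comp] at h₂
  exact ⟨Z.le_trans (g.map_le h₁.1) h₂.1, Z.le_trans h₂.2 (g.map_le h₁.2)⟩

/-- An `(L,V)`-category is cocomplete as soon as the Yoneda embedding has a left inverse up to
equivalence. -/
theorem LVCat.isCocomplete_iff (X : LVCat V) :
    X.IsCocomplete ↔ ∃ S : LVFunctor (presheafLV X) X,
      ∀ x, X.le (S.toFun (yonedaObj X x)) x ∧ X.le x (S.toFun (yonedaObj X x)) := by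
  constructor
  · rintro ⟨S, hS⟩
    refine ⟨S, fun x => ⟨LVFunctor.le_iff.1 hS.2 x, ?_⟩⟩
    have h := LVFunctor.le_iff.1 hS.1 (yonedaObj X x)
    have h' := le_presheafHom_iff.1 h [[x]]
    simp only [listRel, one_mul, mul_one, List.flatten_cons, List.flatten_nil,
      List.append_nil] at h'
    exact _root_.le_trans (X.one_le_hom x) h'
  · rintro ⟨S, hS⟩
    refine ⟨S, LVFunctor.le_iff.2 fun φ => ?_, LVFunctor.le_iff.2 fun x => (hS x).1⟩
    refine le_presheafHom_iff.2 fun xss => ?_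
    match xss with
    | [] => simp [listRel]
    | _ :: _ :: _ => simp [listRel]
    | [xs] =>
      simp only [listRel, one_mul, mul_one, List.flatten_cons, List.flatten_nil, List.append_nil]
      have h₁ : φ.val xs ≤ presheafHom (xs.map (yonedaObj X)) φ := by
        refine le_presheafHom_iff.2 fun xss => ?_
        rw [listRel_map_right, mul_comm]
        exact φ.val_closed xss xs
      have h₂ := S.hom_le (xs.map (yonedaLV X).toFun) φ
      refine h₁.trans (h₂.trans ?_)
      have h₃ := X.hom_comp (xs.map fun x => [x]) ((xs.map (yonedaLV X).toFun).map S.toFun) (S.toFun φ)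
      rw [flatten_map_single] at h₃
      refine _root_.le_trans (le_mul_of_one_le_left' ?_) h₃
      rw [List.map_map, listRel_map_right]
      exact one_le_listRel_map (fun x => (hS x).2) xs

variable (V) in
/-- The objects of `Inj(V)`: cocomplete separated `(L,V)`-categories. -/
structure Inj extends LVCat V where
  isSeparated : toLVCat.IsSeparated
  isCocomplete : toLVCat.IsCocomplete

/-- The morphisms of `Inj(V)`: cocontinuous `(L,V)`-functors. -/
@[ext]
structure InjHom (X Y : Inj V) extends LVFunctor X.toLVCat Y.toLVCat where
  isCocontinuous : toLVFunctor.IsCocontinuous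

/-- The category of cocomplete separated `(L,V)`-categories and cocontinuous functors. -/
instance : Category (Inj V) where
  Hom := InjHom
  id X := ⟨LVFunctor.id X.toLVCat, LVFunctor.isCocontinuous_id⟩
  comp {_ Y _} f g := ⟨g.toLVFunctor.comp f.toLVFunctor,
    g.isCocontinuous.comp f.isCocontinuous Y.isCocomplete⟩

variable (V) in
/-- The forgetful functor `Inj(V) ⥤ Set`. -/
def injForget : Inj V ⥤ Type u where
  obj X := X.carrier
  map f := ↾f.toFun

variable (V) in
/-- The forgetful functor `W : Mon(Alg(P_V)) ⥤ Set`. -/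
def monForget : Mon (PowAlg V) ⥤ Type u := Mon.forget (PowAlg V) ⋙ (powMonad V).forget

end Multi
end
end QuantMulti

/-!
A `P_V`-algebra `A` is the same thing as a separated `V`-category with all weighted suprema of
points. Its `V`-valued hom `homAlg A x y` is the largest `v` with `v • x ≤ y`, and the structure map
is recovered from it by the universal property `le_homAlg_act_iff`:
`v ≤ [act φ, y]` if and only if `v ⊗ φ(x) ≤ [x, y]` for all `x`.

A monoid `M` in `P_V`-algebras therefore represents an `(L,V)`-category, `monLV M`, with hom
`[x₁ ⋯ xₙ, y]`. It is separated because `homAlg` is antisymmetric. It is cocomplete because the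
supremum of the products `x₁ ⋯ xₙ`, weighted by a presheaf, is left adjoint to the Yoneda embedding;
that this assignment is an `(L,V)`-functor uses that multiplication preserves weighted suprema in
each variable (`le_homAlg_mul_prod_wsum`). A morphism of monoids preserves products and weighted
suprema and is thus a cocontinuous functor. This defines `monToInj`, which does not change
underlying sets and functions.

Conversely, in a cocomplete separated `(L,V)`-category `X` each weight `w` on lists has a supremum
`lvSup X w`, and these suprema have a universal property in all variables simultaneously
(`le_hom_map_lvSup_iff`). Two kinds of weights matter. The weight concentrated at one list gives a
point `lvProd X xs` that represents the homs out of `xs`, hence an associative multiplication with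
unit `lvProd X []`. The weights concentrated at lists of length one give the structure map `lvAct X`
of a `P_V`-algebra. The universal property in two variables says that the multiplication is a
bimorphism, and the monoid `lvMon X` so obtained represents `X` itself (`monInj_lvMon`), so that
`monToInj` is essentially surjective. A cocontinuous functor preserves all the suprema `lvSup`
(`map_lvSup`), in particular multiplication, unit and structure map, so that `monToInj` is full.
-/

namespace QuantMulti

noncomputable section

variable {V : Type u} [CommMonoid V] [CompleteLattice V] [IsQuantale V]

/-! ### The `V`-category structure of a `P_V`-algebra -/

/-- The `V`-valued hom of a `P_V`-algebra. For the order and the action of `V` on `A` it is the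
largest `v` with `v • x ≤ y`; the definition avoids both by using that `v • x ≤ y` holds exactly
when `y` is the value of some formal combination in which `x` has weight at least `v`. -/
def homAlg (A : PowAlg V) (x y : A.A) : V := ⨆ (φ : A.A → V) (_ : act A φ = y), φ x

theorem le_homAlg {A : PowAlg V} {φ : A.A → V} {y : A.A} (h : act A φ = y) (x : A.A) :
    φ x ≤ homAlg A x y :=
  le_iSup₂_of_le φ h le_rfl

/-- The supremum defining `homAlg A · y` is attained: the weights with value `y` have a largest
element. -/
theorem act_homAlg (A : PowAlg V) (y : A.A) : act A (fun x => homAlg A x y) = y := by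
  have h : (fun x => homAlg A x y) = pmul (fun φ => ⨆ _ : act A φ = y, (1 : V)) := by
    funext x
    simp only [homAlg, pmul, prop_iSup_mul, one_mul]
  have h' : pmap (act A) (fun φ => ⨆ _ : act A φ = y, (1 : V)) = diag y := by
    funext z
    apply le_antisymm
    · refine iSup₂_le fun φ hφ => iSup_le fun hφ' => ?_
      simp [diag, ← hφ, hφ']
    · unfold diag
      split_ifs with e
      · exact le_iSup₂_of_le (diag y) ((act_diag A y).trans e)
          (le_iSup_of_le (act_diag A y) le_rfl)
      · exact bot_le
  rw [h, act_pmul, h', act_diag]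

theorem homAlg_trans (A : PowAlg V) (x y z : A.A) :
    homAlg A x y * homAlg A y z ≤ homAlg A x z := by
  have h : act A (pmul (pmap (fun y x => homAlg A x y) fun y => homAlg A y z)) = z := by
    rw [act_pmul, pmap_pmap]
    simp only [act_homAlg, pmap_id]
  refine le_trans ?_ (le_homAlg h x)
  rw [mul_comm]
  simp only [pmul]
  rw [iSup_pmap_mul _ _ (fun ψ : A.A → V => ψ x)]
  exact le_iSup (fun y => homAlg A y z * homAlg A x y) y

theorem one_le_homAlg (A : PowAlg V) (x : A.A) : 1 ≤ homAlg A x x := by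
  simpa [diag] using le_homAlg (act_diag A x) x

/-- The value `act A φ` is the `φ`-weighted supremum in the `V`-category `(A, homAlg A)`. -/
theorem le_homAlg_act_iff {A : PowAlg V} {φ : A.A → V} {y : A.A} {v : V} :
    v ≤ homAlg A (act A φ) y ↔ ∀ x, v * φ x ≤ homAlg A x y := by
  constructor
  · intro h x
    rw [mul_comm]
    exact (mul_le_mul' (le_homAlg rfl x) h).trans (homAlg_trans A _ _ _)
  · intro h
    -- Since `v * φ` lies below `homAlg A · y`, adding it does not change the value `y`.
    let Ψ : (A.A → V) → V := fun ψ => diag (fun x => homAlg A x y) ψ ⊔ v * diag φ ψ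
    have h₁ : pmul Ψ = fun x => homAlg A x y := by
      funext x
      simp only [pmul, Ψ, Quantale.sup_mul_distrib, iSup_sup_eq]
      rw [iSup_diag_mul _ (fun ψ : A.A → V => ψ x)]
      simp only [mul_assoc, ← Quantale.mul_iSup_distrib]
      rw [iSup_diag_mul _ (fun ψ : A.A → V => ψ x)]
      exact sup_eq_left.2 (h x)
    have h₂ : act A (pmap (act A) Ψ) = y := by rw [← act_pmul, h₁, act_homAlg]
    refine le_trans ?_ (le_homAlg h₂ _)
    refine le_iSup₂_of_le φ rfl ?_
    simp [Ψ, diag]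

theorem le_homAlg_wsum_iff {A : PowAlg V} {I : Type u} {Φ : I → V} {g : I → A.A} {y : A.A}
    {v : V} : v ≤ homAlg A (wsum A Φ g) y ↔ ∀ i, v * Φ i ≤ homAlg A (g i) y := by
  rw [wsum, le_homAlg_act_iff]
  simp only [pmap, Quantale.mul_iSup_distrib, iSup_le_iff]
  exact ⟨fun h i => by simpa using (h (g i) i), fun h x i => by
    by_cases e : g i = x
    · subst e; simpa using h i
    · simp [e]⟩

theorem homAlg_antisymm {A : PowAlg V} {x y : A.A} (h : 1 ≤ homAlg A x y)
    (h' : 1 ≤ homAlg A y x) : x = y := by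
  rw [← act_homAlg A x, ← act_homAlg A y]
  congr 1
  funext z
  exact le_antisymm ((le_mul_of_one_le_right' h).trans (homAlg_trans A _ _ _))
    ((le_mul_of_one_le_right' h').trans (homAlg_trans A _ _ _))

theorem IsHomFun.homAlg_le {A B : PowAlg V} {f : A.A → B.A} (hf : IsHomFun A B f) (x y : A.A) :
    homAlg A x y ≤ homAlg B (f x) (f y) := by
  have h : act B (pmap f fun x => homAlg A x y) = f y := by rw [← hf, act_homAlg]
  refine le_trans ?_ (le_homAlg h (f x))
  exact le_iSup₂_of_le (f := fun x' (_ : f x' = f x) => homAlg A x' y) x rfl le_rfl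

/-! ### Left adjoints of the Yoneda embedding as weighted suprema -/

theorem LVCat.hom_le_of_le (X : LVCat V) {x y : X.carrier} (h : X.le x y)
    (xs : List X.carrier) : X.hom xs x ≤ X.hom xs y := by
  have := X.hom_comp [xs] [x] y
  simp only [listRel, mul_one, List.flatten_cons, List.flatten_nil, List.append_nil] at this
  exact (le_mul_of_one_le_right' h).trans this

theorem LVCat.hom_map_le {X : LVCat V} {I : Type u} {f g : I → X.carrier}
    (h : ∀ i, X.le (f i) (g i)) (is : List I) (y : X.carrier) :
    X.hom (is.map g) y ≤ X.hom (is.map f) y := by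
  have h₁ := X.hom_comp ((is.map f).map fun x => [x]) (is.map g) y
  rw [flatten_map_single] at h₁
  refine _root_.le_trans (le_mul_of_one_le_left' ?_) h₁
  rw [listRel_map_right, List.map_map]
  exact one_le_listRel_map (r := fun xs i => X.hom xs (g i)) (f := fun i => [f i]) h is

/-- Points of a separated `(L,V)`-category are determined by the unary homs out of them. -/
theorem LVCat.IsSeparated.eq_of_hom {X : LVCat V} (hX : X.IsSeparated) {x y : X.carrier}
    (h : ∀ v z, v ≤ X.hom [x] z ↔ v ≤ X.hom [y] z) : x = y :=
  hX.eq ((h _ _).2 (X.one_le_hom y)) ((h _ _).1 (X.one_le_hom x))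

/-- A left adjoint of the Yoneda embedding computes suprema in all variables simultaneously. -/
theorem LVFunctor.IsAdjoint.le_hom_map_iff {X : LVCat V} {S : LVFunctor (presheafLV X) X}
    (hS : S.IsAdjoint (yonedaLV X)) {fs : List (Presheaf X)} {y : X.carrier} {v : V} :
    v ≤ X.hom (fs.map S.toFun) y ↔ ∀ xss : List (List X.carrier),
      v * listRel (fun xs (f : Presheaf X) => f.val xs) xss fs ≤ X.hom xss.flatten y := by
  refine Iff.trans ?_ (le_presheafHom_iff (g := yonedaObj X y))
  suffices h : X.hom (fs.map S.toFun) y = presheafHom fs (yonedaObj X y) by rw [h]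
  apply le_antisymm
  · refine ((yonedaLV X).hom_le _ _).trans ?_
    have h := LVCat.hom_map_le (X := presheafLV X) (f := fun φ => φ)
      (g := fun φ => yonedaObj X (S.toFun φ)) (LVFunctor.le_iff.1 hS.1) fs (yonedaObj X y)
    have e : fs.map (fun φ => φ) = fs := List.map_id' fs
    have e' : (fs.map S.toFun).map (yonedaLV X).toFun =
        fs.map fun φ => yonedaObj X (S.toFun φ) := List.map_map
    refine (congrArg (fun l => presheafHom l (yonedaObj X y)) e').trans_le ?_
    exact h.trans_eq (congrArg (fun l => presheafHom l (yonedaObj X y)) e)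
  · exact (S.hom_le fs (yonedaObj X y)).trans (X.hom_le_of_le (LVFunctor.le_iff.1 hS.2 y) _)

theorem LVFunctor.IsAdjoint.le_hom_iff {X : LVCat V} {S : LVFunctor (presheafLV X) X}
    (hS : S.IsAdjoint (yonedaLV X)) {φ : Presheaf X} {y : X.carrier} {v : V} :
    v ≤ X.hom [S.toFun φ] y ↔ ∀ xs, v * φ.val xs ≤ X.hom xs y := by
  refine (hS.le_hom_map_iff (fs := [φ])).trans ⟨fun h xs => ?_, fun h xss => ?_⟩
  · simpa [listRel] using h [xs]
  · match xss with
    | [] => simp [listRel]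
    | [xs] => simpa [listRel] using h xs
    | _ :: _ :: _ => simp [listRel]

/-- The presheaf generated by a weight on lists. -/
def presheafGen (X : LVCat V) (w : List X.carrier → V) : Presheaf X where
  rel := bullet (fun xs _ => w xs) X.hom
  bullet_left := (bullet_bullet_le _ _ _).trans (bullet_mono_right _ X.bullet_le)
  bullet_right := lunit_bullet_le _

theorem le_presheafGen (X : LVCat V) (w : List X.carrier → V) (xs : List X.carrier) :
    w xs ≤ (presheafGen X w).val xs := by
  have h := mul_le_bullet (fun xs (_ : PUnit.{u + 1}) => w xs) X.hom (xs.map fun x => [x]) xs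
    PUnit.unit
  rw [flatten_map_single] at h
  exact _root_.le_trans (le_mul_of_one_le_left' (one_le_listRel_map (fun x => X.one_le_hom x) xs)) h

/-- A multilinear bound holds for weights exactly when it holds for the presheaves that they
generate. -/
theorem listRel_presheafGen_le_iff {X : LVCat V} {ws : List (List X.carrier → V)}
    {y : X.carrier} {v : V} :
    (∀ xss : List (List X.carrier), v * listRel (fun xs (f : Presheaf X) => f.val xs) xss
        (ws.map (presheafGen X)) ≤ X.hom xss.flatten y) ↔
      ∀ xss : List (List X.carrier),
        v * listRel (fun xs (w : List X.carrier → V) => w xs) xss ws ≤ X.hom xss.flatten y := by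
  constructor
  · refine fun h xss => le_trans (mul_le_mul_right ?_ v) (h xss)
    rw [listRel_map_right]
    exact listRel_mono (fun xs w => le_presheafGen X w xs) xss ws
  · intro h xss
    -- Let `t` take the value `v` at the list `ws` and `⊥` elsewhere, and let `W` evaluate weights.
    -- The hypothesis reads `t • W ≤ a(-, y)` and the claim reads `t • (W • a) ≤ a(-, y)`.
    let t : List (List X.carrier → V) → PUnit.{u + 1} → V := fun us _ => ⨆ _ : us = ws, v
    let W : List X.carrier → (List X.carrier → V) → V := fun xs w => w xs
    have h₁ : bullet t W ≤ fun xs _ => X.hom xs y := bullet_le_iff.2 fun xss us _ => by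
      change listRel W xss us * (⨆ _ : us = ws, v) ≤ _
      rw [mul_prop_iSup]
      refine iSup_le fun e => ?_
      subst e
      rw [mul_comm]
      exact h xss
    have h₂ : bullet t (bullet W X.hom) ≤ fun xs _ => X.hom xs y := by
      rw [← bullet_assoc]
      refine (bullet_mono_left _ h₁).trans ?_
      exact bullet_le_iff.2 fun xss ys _ => X.hom_comp xss ys y
    refine _root_.le_trans ?_ (bullet_le_iff.1 h₂ xss ws PUnit.unit)
    rw [listRel_map_right, mul_comm]
    exact mul_le_mul_right (le_iSup (fun _ : ws = ws => v) rfl) _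

/-- The image presheaf `D_L(f)(φ)` has the supremum of `f` weighted by `φ`. -/
theorem LVFunctor.IsAdjoint.le_hom_presheafMap_iff {X Y : LVCat V} (f : LVFunctor X Y)
    {T : LVFunctor (presheafLV Y) Y} (hT : T.IsAdjoint (yonedaLV Y)) {φ : Presheaf X}
    {y : Y.carrier} {v : V} : v ≤ Y.hom [T.toFun (presheafMap f φ)] y ↔
      ∀ xs, v * φ.val xs ≤ Y.hom (xs.map f.toFun) y := by
  rw [hT.le_hom_iff]
  constructor
  · intro h xs
    refine _root_.le_trans (mul_le_mul_right ?_ v) (h _)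
    have h' := mul_le_bullet φ.rel (upperStar f).rel (xs.map fun x => [f.toFun x]) xs PUnit.unit
    have e : (xs.map fun x => [f.toFun x]).flatten = xs.map f.toFun := by
      rw [← flatten_map_single (xs.map f.toFun), List.map_map]; rfl
    rw [e] at h'
    exact _root_.le_trans (le_mul_of_one_le_left' (one_le_listRel_map
      (r := fun ys x => Y.hom ys (f.toFun x)) (fun x => Y.one_le_hom _) xs)) h'
  · intro h
    suffices h' : bullet φ.rel (upperStar f).rel ≤
        fun ys _ => Quantale.leftMulResiduation v (Y.hom ys y) from fun ys => by
      rw [mul_comm, ← Quantale.leftMulResiduation_le_iff_mul_le]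
      exact h' ys PUnit.unit
    refine bullet_le_iff.2 fun yss xs _ => ?_
    rw [Quantale.leftMulResiduation_le_iff_mul_le, mul_assoc, mul_comm (φ.rel _ _)]
    refine (mul_le_mul_right (h xs) _).trans ?_
    rw [show listRel (upperStar f).rel yss xs = listRel Y.hom yss (xs.map f.toFun) from
      (listRel_map_right Y.hom f.toFun yss xs).symm]
    exact Y.hom_comp _ _ _

/-! ### The cocomplete `(L,V)`-category of a monoid -/

open MonoidalCategory in
theorem mon_one_mul (M : Mon (PowAlg V)) (x : M.X.A) :
    (MonObj.mul (X := M.X)).f (tmul ((MonObj.one (X := M.X)).f (unitPt V)) x) = x := by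
  have h := congrArg (fun g : 𝟙_ (PowAlg V) ⊗ M.X ⟶ M.X => g.f (tmul (unitPt V) x))
    (MonObj.one_mul M.X)
  change (MonObj.mul (X := M.X)).f
    ((tensorMap (MonObj.one (X := M.X)) (𝟙 M.X)).f (tmul (unitPt V) x)) =
    (leftUnitorAlg M.X).hom.f (tmul (unitPt V) x) at h
  rwa [tensorMap_tmul, leftUnitorAlg_tmul, smulAlg_unitPt, alg_id_apply] at h

open MonoidalCategory in
theorem mon_mul_one (M : Mon (PowAlg V)) (x : M.X.A) :
    (MonObj.mul (X := M.X)).f (tmul x ((MonObj.one (X := M.X)).f (unitPt V))) = x := by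
  have h := congrArg (fun g : M.X ⊗ 𝟙_ (PowAlg V) ⟶ M.X => g.f (tmul x (unitPt V)))
    (MonObj.mul_one M.X)
  change (MonObj.mul (X := M.X)).f
    ((tensorMap (𝟙 M.X) (MonObj.one (X := M.X))).f (tmul x (unitPt V))) =
    (rightUnitorAlg M.X).hom.f (tmul x (unitPt V)) at h
  rwa [tensorMap_tmul, rightUnitorAlg_tmul, smulAlg_unitPt, alg_id_apply] at h

open MonoidalCategory in
theorem mon_mul_assoc (M : Mon (PowAlg V)) (x y z : M.X.A) :
    (MonObj.mul (X := M.X)).f (tmul ((MonObj.mul (X := M.X)).f (tmul x y)) z) =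
      (MonObj.mul (X := M.X)).f (tmul x ((MonObj.mul (X := M.X)).f (tmul y z))) := by
  have h := congrArg (fun g : (M.X ⊗ M.X) ⊗ M.X ⟶ M.X => g.f (tmul (tmul x y) z))
    (MonObj.mul_assoc M.X)
  change (MonObj.mul (X := M.X)).f
    ((tensorMap (MonObj.mul (X := M.X)) (𝟙 M.X)).f (tmul (tmul x y) z)) =
    (MonObj.mul (X := M.X)).f ((tensorMap (𝟙 M.X) (MonObj.mul (X := M.X))).f
      ((assocHom M.X M.X M.X).f (tmul (tmul x y) z))) at h
  rwa [assocHom_tmul, tensorMap_tmul, tensorMap_tmul, alg_id_apply, alg_id_apply] at h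

/-- The multiplication on the underlying set of a monoid in `P_V`-algebras. -/
instance monMonoid (M : Mon (PowAlg V)) : Monoid M.X.A where
  mul x y := (MonObj.mul (X := M.X)).f (tmul x y)
  one := (MonObj.one (X := M.X)).f (unitPt V)
  mul_assoc := mon_mul_assoc M
  one_mul := mon_one_mul M
  mul_one := mon_mul_one M

theorem isBimorphism_mul (M : Mon (PowAlg V)) :
    IsBimorphism M.X M.X M.X fun x y : M.X.A => x * y :=
  ⟨fun x => (isHomFun_of_hom (MonObj.mul (X := M.X))).comp ((isBimorphism_tmul _ _).1 x),
    fun y => (isHomFun_of_hom (MonObj.mul (X := M.X))).comp ((isBimorphism_tmul _ _).2 y)⟩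

theorem listRel_homAlg_le (M : Mon (PowAlg V)) (xss : List (List M.X.A)) (ys : List M.X.A) :
    listRel (fun xs y => homAlg M.X xs.prod y) xss ys ≤ homAlg M.X xss.flatten.prod ys.prod := by
  induction xss generalizing ys with
  | nil =>
    cases ys with
    | nil => exact one_le_homAlg M.X _
    | cons y ys => exact bot_le
  | cons xs xss ih =>
    cases ys with
    | nil => exact bot_le
    | cons y ys =>
      rw [List.flatten_cons, List.prod_append, List.prod_cons]
      exact (mul_le_mul' (((isBimorphism_mul M).2 xss.flatten.prod).homAlg_le xs.prod y)
        ((ih ys).trans (((isBimorphism_mul M).1 y).homAlg_le _ _))).trans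
        (homAlg_trans M.X _ _ _)

/-- The `(L,V)`-category that a monoid represents, with hom `[x₁ ⋯ xₙ, y]`. -/
def monLV (M : Mon (PowAlg V)) : LVCat V where
  carrier := M.X.A
  hom xs y := homAlg M.X xs.prod y
  lunit_le xs y := by
    simp only [lunit, conv, graph, diag]
    split_ifs with e
    · subst e
      rw [List.prod_singleton]
      exact one_le_homAlg M.X y
    · exact bot_le
  bullet_le := bullet_le_iff.2 fun xss ys z =>
    (mul_le_mul_left (listRel_homAlg_le M xss ys) _).trans (homAlg_trans M.X _ _ _)

theorem monLV_hom_singleton (M : Mon (PowAlg V)) (x y : M.X.A) :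
    (monLV M).hom [x] y = homAlg M.X x y :=
  congrArg (homAlg M.X · y) List.prod_singleton

theorem monLV_isSeparated (M : Mon (PowAlg V)) : (monLV M).IsSeparated := by
  intro Y f g h h'
  ext y
  refine homAlg_antisymm (A := M.X) ?_ ?_
  · exact (LVFunctor.le_iff.1 h y).trans_eq (monLV_hom_singleton M _ _)
  · exact (LVFunctor.le_iff.1 h' y).trans_eq (monLV_hom_singleton M _ _)

/-- A bound on a product of weighted suprema can be checked on products of lists, since
multiplication preserves weighted suprema in each variable. -/
theorem le_homAlg_mul_prod_wsum (M : Mon (PowAlg V)) {I : Type u} (w : List M.X.A → I → V)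
    (is : List I) (z y : M.X.A) (v : V)
    (h : ∀ xss : List (List M.X.A),
      v * listRel w xss is ≤ homAlg M.X (z * xss.flatten.prod) y) :
    v ≤ homAlg M.X
      (z * (is.map fun i => wsum M.X (fun xs => w xs i) List.prod).prod) y := by
  induction is generalizing z v with
  | nil => simpa [listRel] using h []
  | cons i is ih =>
    rw [List.map_cons, List.prod_cons, ← mul_assoc,
      (((isBimorphism_mul M).2 _).comp ((isBimorphism_mul M).1 z)).wsum, le_homAlg_wsum_iff]
    refine fun xs => ih _ _ fun xss => ?_
    have := h (xs :: xss)
    rwa [listRel, List.flatten_cons, List.prod_append, ← mul_assoc, ← mul_assoc] at this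

/-- The left adjoint of the Yoneda embedding: a presheaf is sent to the supremum of the products
of lists, weighted by the presheaf. -/
def monSup (M : Mon (PowAlg V)) : LVFunctor (presheafLV (monLV M)) (monLV M) where
  toFun φ := wsum M.X (I := List M.X.A) φ.val List.prod
  hom_le fs g := by
    have := le_homAlg_mul_prod_wsum M (fun xs (f : Presheaf (monLV M)) => f.val xs) fs 1
      (wsum M.X (I := List M.X.A) g.val List.prod) (presheafHom fs g) fun xss => by
        rw [one_mul (M := M.X.A)]
        refine (le_presheafHom_iff (X := monLV M).1 le_rfl xss).trans ?_
        have h := le_homAlg_wsum_iff.1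
          (one_le_homAlg M.X (wsum M.X (I := List M.X.A) g.val List.prod)) xss.flatten
        rwa [one_mul] at h
    rw [one_mul (M := M.X.A)] at this
    exact this

theorem monSup_yonedaObj (M : Mon (PowAlg V)) (x : M.X.A) :
    (monSup M).toFun (yonedaObj (monLV M) x) = x := by
  have h : pmap List.prod (fun xs : List M.X.A => homAlg M.X xs.prod x) =
      fun y => homAlg M.X y x := by
    funext y
    apply le_antisymm
    · refine iSup₂_le fun xs e => ?_
      exact e ▸ le_rfl
    · refine le_iSup₂_of_le [y] List.prod_singleton ?_
      exact (congrArg (homAlg M.X · x) List.prod_singleton).ge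
  change act M.X (pmap _ fun xs : List M.X.A => homAlg M.X xs.prod x) = x
  rw [h, act_homAlg]

theorem monLV_isCocomplete (M : Mon (PowAlg V)) : (monLV M).IsCocomplete :=
  (LVCat.isCocomplete_iff _).2 ⟨monSup M, fun x => by
    have h : (monSup M).toFun (yonedaObj (monLV M) x) = x := monSup_yonedaObj M x
    exact ⟨h.symm ▸ LVCat.le_refl _ x, h.symm ▸ LVCat.le_refl _ x⟩⟩

/-- The object of `Inj(V)` that a monoid represents. -/
def monInj (M : Mon (PowAlg V)) : Inj V where
  toLVCat := monLV M
  isSeparated := monLV_isSeparated M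
  isCocomplete := monLV_isCocomplete M

theorem hom_mul {M N : Mon (PowAlg V)} (f : M ⟶ N) (x y : M.X.A) :
    f.hom.f (x * y) = (f.hom.f x * f.hom.f y : N.X.A) := by
  have h := congrArg (fun g : tensorAlg M.X M.X ⟶ N.X => g.f (tmul x y)) (IsMonHom.mul_hom f.hom)
  change f.hom.f (x * y) =
    (MonObj.mul (X := N.X)).f ((tensorMap f.hom f.hom).f (tmul x y)) at h
  rwa [tensorMap_tmul] at h

theorem hom_one {M N : Mon (PowAlg V)} (f : M ⟶ N) : f.hom.f (1 : M.X.A) = (1 : N.X.A) :=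
  congrArg (fun g : unitAlg V ⟶ N.X => g.f (unitPt V)) (IsMonHom.one_hom f.hom)

theorem hom_prod {M N : Mon (PowAlg V)} (f : M ⟶ N) (xs : List M.X.A) :
    f.hom.f xs.prod = (xs.map f.hom.f : List N.X.A).prod := by
  induction xs with
  | nil => exact hom_one f
  | cons x xs ih => rw [List.prod_cons, hom_mul, ih]; rfl

theorem le_monLV_hom_wsum_iff (M : Mon (PowAlg V)) {I : Type u} {Φ : I → V}
    {g : I → List M.X.A} {y : M.X.A} {v : V} :
    v ≤ (monLV M).hom [wsum M.X Φ fun i => (g i).prod] y ↔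
      ∀ i, v * Φ i ≤ (monLV M).hom (g i) y := by
  refine Iff.trans ?_ le_homAlg_wsum_iff
  exact iff_of_eq (congrArg (v ≤ ·) (monLV_hom_singleton M _ y))

theorem hom_wsum_prod {M N : Mon (PowAlg V)} (f : M ⟶ N) {I : Type u} (Φ : I → V)
    (g : I → List M.X.A) : f.hom.f (wsum M.X Φ fun i => (g i).prod) =
      wsum N.X Φ fun i => ((g i).map f.hom.f : List N.X.A).prod := by
  rw [(isHomFun_of_hom f.hom).wsum]
  simp only [hom_prod]

/-- The `(L,V)`-functor underlying a morphism of monoids. -/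
def monLVMap {M N : Mon (PowAlg V)} (f : M ⟶ N) : LVFunctor (monLV M) (monLV N) where
  toFun := f.hom.f
  hom_le xs x := ((isHomFun_of_hom f.hom).homAlg_le (List.prod (α := M.X.A) xs) x).trans_eq
    (congrArg (homAlg N.X · (f.hom.f x)) (hom_prod f xs))

theorem monLVMap_isCocontinuous {M N : Mon (PowAlg V)} (f : M ⟶ N) :
    (monLVMap f).IsCocontinuous := by
  intro S T hS hT φ
  have h₁ : S.toFun φ = wsum M.X (I := List M.X.A) φ.val fun xs => xs.prod :=
    (monLV_isSeparated M).eq_of_hom fun v y =>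
      hS.le_hom_iff.trans (le_monLV_hom_wsum_iff M (g := fun xs => xs)).symm
  have h₂ : (monLVMap f).toFun (S.toFun φ) = T.toFun (presheafMap (monLVMap f) φ) := by
    rw [h₁]
    refine Eq.trans (hom_wsum_prod f _ _) ((monLV_isSeparated N).eq_of_hom fun v y => ?_)
    exact (le_monLV_hom_wsum_iff N).trans (hT.le_hom_presheafMap_iff (monLVMap f)).symm
  rw [h₂]
  exact ⟨LVCat.le_refl _ _, LVCat.le_refl _ _⟩

variable (V) in
/-- The comparison functor from monoids in `P_V`-algebras to `Inj(V)`, the identity on underlying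
sets and functions. -/
def monToInj : Mon (PowAlg V) ⥤ Inj V where
  obj := monInj
  map f := (⟨monLVMap f, monLVMap_isCocontinuous f⟩ : InjHom _ _)

/-! ### The operations of a cocomplete separated `(L,V)`-category -/

/-- The supremum of a weight on lists. -/
def lvSup (X : Inj V) (w : List X.carrier → V) : X.carrier :=
  X.isCocomplete.choose.toFun (presheafGen X.toLVCat w)

/-- The universal property of `lvSup`, in all variables simultaneously. -/
theorem le_hom_map_lvSup_iff {X : Inj V} {ws : List (List X.carrier → V)} {y : X.carrier} {v : V} :
    v ≤ X.hom (ws.map (lvSup X)) y ↔ ∀ xss : List (List X.carrier),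
      v * listRel (fun xs (w : List X.carrier → V) => w xs) xss ws ≤ X.hom xss.flatten y := by
  refine Iff.trans ?_ listRel_presheafGen_le_iff
  refine Iff.trans ?_ X.isCocomplete.choose_spec.le_hom_map_iff
  have e : (ws.map (presheafGen X.toLVCat)).map X.isCocomplete.choose.toFun = ws.map (lvSup X) :=
    List.map_map
  exact iff_of_eq (congrArg (fun l => v ≤ X.hom l y) e.symm)

theorem le_hom_lvSup_iff {X : Inj V} {w : List X.carrier → V} {y : X.carrier} {v : V} :
    v ≤ X.hom [lvSup X w] y ↔ ∀ xs, v * w xs ≤ X.hom xs y := by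
  refine (le_hom_map_lvSup_iff (ws := [w])).trans ⟨fun h xs => ?_, fun h xss => ?_⟩
  · simpa [listRel] using h [xs]
  · match xss with
    | [] => simp [listRel]
    | [xs] => simpa [listRel] using h xs
    | _ :: _ :: _ => simp [listRel]

theorem le_hom_lvSup_lvSup_iff {X : Inj V} {w w' : List X.carrier → V} {y : X.carrier} {v : V} :
    v ≤ X.hom [lvSup X w, lvSup X w'] y ↔
      ∀ xs xs', v * (w xs * w' xs') ≤ X.hom (xs ++ xs') y := by
  refine (le_hom_map_lvSup_iff (ws := [w, w'])).trans ⟨fun h xs xs' => ?_, fun h xss => ?_⟩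
  · simpa [listRel] using h [xs, xs']
  · match xss with
    | [] => simp [listRel]
    | [_] => simp [listRel]
    | [xs, xs'] => simpa [listRel] using h xs xs'
    | _ :: _ :: _ :: _ => simp [listRel]

/-- The universal property in one variable determines the supremum. -/
theorem eq_lvSup {X : Inj V} {w : List X.carrier → V} {x : X.carrier}
    (h : ∀ v y, v ≤ X.hom [x] y ↔ ∀ xs, v * w xs ≤ X.hom xs y) : x = lvSup X w :=
  X.isSeparated.eq_of_hom fun v y => (h v y).trans le_hom_lvSup_iff.symm

theorem mul_diag_le_iff {X : Type u} {x : X} {v : V} {t : X → V} :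
    (∀ x', v * diag x x' ≤ t x') ↔ v ≤ t x := by
  constructor
  · intro h
    simpa [diag] using h x
  · intro h x'
    unfold diag
    split_ifs with e
    · subst e
      simpa using h
    · simp

theorem mul_pmap_le_iff {X Y : Type u} {f : X → Y} {φ : X → V} {v : V} {t : Y → V} :
    (∀ y, v * pmap f φ y ≤ t y) ↔ ∀ x, v * φ x ≤ t (f x) := by
  constructor
  · refine fun h x => le_trans (mul_le_mul_right ?_ v) (h (f x))
    exact le_iSup₂_of_le (f := fun x' (_ : f x' = f x) => φ x') x rfl le_rfl
  · intro h y
    simp only [pmap, Quantale.mul_iSup_distrib, mul_prop_iSup]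
    refine iSup₂_le fun x e => ?_
    subst e
    exact h x

/-- The tensor product of a list of points: the point that represents the homs out of it. -/
def lvProd (X : Inj V) (xs : List X.carrier) : X.carrier := lvSup X (diag xs)

theorem hom_lvProd (X : Inj V) (xs : List X.carrier) (y : X.carrier) :
    X.hom [lvProd X xs] y = X.hom xs y :=
  eq_of_forall_le_iff fun _ => le_hom_lvSup_iff.trans mul_diag_le_iff

theorem lvProd_singleton (X : Inj V) (x : X.carrier) : lvProd X [x] = x :=
  X.isSeparated.eq_of_hom fun v y => by rw [hom_lvProd]

theorem hom_lvProd_lvProd (X : Inj V) (xs xs' : List X.carrier) (y : X.carrier) :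
    X.hom [lvProd X xs, lvProd X xs'] y = X.hom (xs ++ xs') y := by
  refine eq_of_forall_le_iff fun v => le_hom_lvSup_lvSup_iff.trans ?_
  simp only [← mul_assoc]
  refine (forall_congr' fun as => mul_diag_le_iff (t := fun bs => X.hom (as ++ bs) y)).trans ?_
  exact mul_diag_le_iff (t := fun as => X.hom (as ++ xs') y)

theorem lvProd_lvProd (X : Inj V) (xs xs' : List X.carrier) :
    lvProd X [lvProd X xs, lvProd X xs'] = lvProd X (xs ++ xs') :=
  X.isSeparated.eq_of_hom fun v y => by rw [hom_lvProd, hom_lvProd, hom_lvProd_lvProd]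

/-- The supremum of a weight on points. -/
def lvAct (X : Inj V) (φ : X.carrier → V) : X.carrier := lvSup X (pmap (fun x => [x]) φ)

theorem le_hom_lvAct_iff {X : Inj V} {φ : X.carrier → V} {y : X.carrier} {v : V} :
    v ≤ X.hom [lvAct X φ] y ↔ ∀ x, v * φ x ≤ X.hom [x] y :=
  le_hom_lvSup_iff.trans mul_pmap_le_iff

/-- The `P_V`-algebra of weighted suprema of points. -/
def lvAlg (X : Inj V) : PowAlg V :=
  mkAlg X.carrier (lvAct X)
    (fun x => X.isSeparated.eq_of_hom fun v y => by
      rw [le_hom_lvAct_iff]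
      exact mul_diag_le_iff (t := fun x => X.hom [x] y))
    (fun Φ => X.isSeparated.eq_of_hom fun v y => by
      rw [le_hom_lvAct_iff, le_hom_lvAct_iff,
        mul_pmap_le_iff (t := fun x => X.hom [x] y)]
      simp only [le_hom_lvAct_iff, pmul, Quantale.mul_iSup_distrib, iSup_le_iff, mul_assoc]
      exact forall_comm)

theorem homAlg_lvAlg (X : Inj V) (x y : X.carrier) : homAlg (lvAlg X) x y = X.hom [x] y := by
  apply le_antisymm
  · refine iSup₂_le fun φ h => ?_
    subst h
    have := (le_hom_lvAct_iff (φ := φ)).1 (X.one_le_hom _) x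
    rwa [one_mul] at this
  · refine le_homAlg (A := lvAlg X) (φ := fun x => X.hom [x] y) ?_ x
    refine X.isSeparated.eq_of_hom fun v z => le_hom_lvAct_iff.trans ⟨fun h => ?_, fun h x => ?_⟩
    · exact (le_mul_of_one_le_right' (X.one_le_hom y)).trans (h y)
    · have := X.hom_comp [[x]] [y] z
      simp only [listRel, mul_one, List.flatten_cons, List.flatten_nil, List.append_nil] at this
      rw [mul_comm]
      exact (mul_le_mul_right h _).trans this

theorem le_hom_lvAct_right_iff {X : Inj V} {x y : X.carrier} {φ : X.carrier → V} {v : V} :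
    v ≤ X.hom [x, lvAct X φ] y ↔ ∀ x', v * φ x' ≤ X.hom [x, x'] y := by
  have h := le_hom_lvSup_lvSup_iff (w := diag [x]) (w' := pmap (fun x => [x]) φ) (y := y) (v := v)
  rw [show lvSup X (diag [x]) = x from lvProd_singleton X x] at h
  refine h.trans ?_
  rw [forall_comm]
  simp only [← mul_assoc, mul_right_comm v (diag [x] _)]
  exact (forall_congr' fun bs => mul_diag_le_iff (t := fun as => X.hom (as ++ bs) y)).trans
    (mul_pmap_le_iff (t := fun bs => X.hom ([x] ++ bs) y))

theorem le_hom_lvAct_left_iff {X : Inj V} {x y : X.carrier} {φ : X.carrier → V} {v : V} :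
    v ≤ X.hom [lvAct X φ, x] y ↔ ∀ x', v * φ x' ≤ X.hom [x', x] y := by
  have h := le_hom_lvSup_lvSup_iff (w := pmap (fun x => [x]) φ) (w' := diag [x]) (y := y) (v := v)
  rw [show lvSup X (diag [x]) = x from lvProd_singleton X x] at h
  refine h.trans ?_
  simp only [← mul_assoc]
  exact (forall_congr' fun as => mul_diag_le_iff (t := fun bs => X.hom (as ++ bs) y)).trans
    (mul_pmap_le_iff (t := fun as => X.hom (as ++ [x]) y))

theorem isBimorphism_lvProd (X : Inj V) :
    IsBimorphism (lvAlg X) (lvAlg X) (lvAlg X) fun x y => lvProd X [x, y] := by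
  constructor
  · intro x φ
    refine X.isSeparated.eq_of_hom fun v y => ?_
    refine Iff.trans ?_ (le_hom_lvAct_iff.trans (mul_pmap_le_iff (t := fun x => X.hom [x] y))).symm
    simp only [hom_lvProd]
    exact le_hom_lvAct_right_iff
  · intro x φ
    refine X.isSeparated.eq_of_hom fun v y => ?_
    refine Iff.trans ?_ (le_hom_lvAct_iff.trans (mul_pmap_le_iff (t := fun x => X.hom [x] y))).symm
    simp only [hom_lvProd]
    exact le_hom_lvAct_left_iff

/-! ### The monoid of a cocomplete separated `(L,V)`-category -/

open MonoidalCategory in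
/-- A monoid in `P_V`-algebras, built from a monoid structure that is a bimorphism. -/
def mkMon (A : PowAlg V) (mul : A.A → A.A → A.A) (one : A.A) (hb : IsBimorphism A A A mul)
    (h₁ : ∀ x, mul one x = x) (h₂ : ∀ x, mul x one = x)
    (h₃ : ∀ x y z, mul (mul x y) z = mul x (mul y z)) : Mon (PowAlg V) where
  X := A
  mon :=
    { one := mkHom (A := unitAlg V) (fun v => smulAlg A v one) (isHomFun_smulAlg_left A one)
      mul := tlift mul hb
      one_mul := tensor_ext fun v x => by
        change (tlift mul hb).f ((tensorMap _ (𝟙 A)).f (tmul v x)) =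
          (leftUnitorAlg A).hom.f (tmul v x)
        rw [tensorMap_tmul, tlift_tmul, leftUnitorAlg_tmul, alg_id_apply]
        exact ((hb.2 x).smulAlg v one).trans (congrArg (smulAlg A v) (h₁ x))
      mul_one := tensor_ext fun x v => by
        change (tlift mul hb).f ((tensorMap (𝟙 A) _).f (tmul x v)) =
          (rightUnitorAlg A).hom.f (tmul x v)
        rw [tensorMap_tmul, tlift_tmul, rightUnitorAlg_tmul, alg_id_apply]
        exact ((hb.1 x).smulAlg v one).trans (congrArg (smulAlg A v) (h₂ x))
      mul_assoc := tensor_ext₃ fun x y z => by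
        change (tlift mul hb).f ((tensorMap (tlift mul hb) (𝟙 A)).f (tmul (tmul x y) z)) =
          (tlift mul hb).f ((tensorMap (𝟙 A) (tlift mul hb)).f
            ((assocHom A A A).f (tmul (tmul x y) z)))
        simp only [assocHom_tmul, tensorMap_tmul, tlift_tmul, alg_id_apply]
        exact h₃ x y z }

theorem lvProd_cons (X : Inj V) (x : X.carrier) (xs : List X.carrier) :
    lvProd X [x, lvProd X xs] = lvProd X (x :: xs) := by
  have h := lvProd_lvProd X [x] xs
  rwa [lvProd_singleton] at h

theorem lvProd_pair_singleton (X : Inj V) (xs : List X.carrier) (x : X.carrier) :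
    lvProd X [lvProd X xs, x] = lvProd X (xs ++ [x]) := by
  have h := lvProd_lvProd X xs [x]
  rwa [lvProd_singleton] at h

/-- The monoid of a cocomplete separated `(L,V)`-category, with multiplication `x ⊗ y`. -/
def lvMon (X : Inj V) : Mon (PowAlg V) :=
  mkMon (lvAlg X) (fun x y => lvProd X [x, y]) (lvProd X []) (isBimorphism_lvProd X)
    (fun x => (lvProd_pair_singleton X [] x).trans (lvProd_singleton X x))
    (fun x => (lvProd_cons X x []).trans (lvProd_singleton X x))
    (fun x y z => (lvProd_pair_singleton X [x, y] z).trans (lvProd_cons X x [y, z]).symm)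

theorem lvMon_mul (X : Inj V) (x y : (lvMon X).X.A) : x * y = lvProd X [x, y] :=
  tlift_tmul _ (isBimorphism_lvProd X) x y

theorem lvMon_one (X : Inj V) : (1 : (lvMon X).X.A) = lvProd X [] :=
  smulAlg_unitPt (lvAlg X) _

theorem lvMon_prod (X : Inj V) (xs : List (lvMon X).X.A) : xs.prod = lvProd X xs := by
  induction xs with
  | nil => exact lvMon_one X
  | cons x xs ih => 
    rw [List.prod_cons, ih]
    exact (lvMon_mul X x _).trans (lvProd_cons X x xs)

theorem Inj.mk_eq_mk {C : Type u} {a b : List C → C → V} (h : a = b) {h₁ h₂ h₃ h₄ s s' c c'} :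
    (⟨⟨C, a, h₁, h₂⟩, s, c⟩ : Inj V) = ⟨⟨C, b, h₃, h₄⟩, s', c'⟩ := by
  subst h
  rfl

/-- The comparison is an equality and not just an isomorphism, since the underlying sets coincide. -/
theorem monInj_lvMon (X : Inj V) : monInj (lvMon X) = X :=
  Inj.mk_eq_mk (funext₂ fun xs y =>
    (congrArg (homAlg (lvAlg X) · y) (lvMon_prod X xs)).trans
      ((homAlg_lvAlg X _ _).trans (hom_lvProd X xs y)))

/-! ### Cocontinuous functors preserve the operations -/

theorem listRel_le_listRel_map {X Y Z W : Type u} {r : X → Y → V} {s : Z → W → V} {f : X → Z}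
    {g : Y → W} (h : ∀ x y, r x y ≤ s (f x) (g y)) (xs : List X) (ys : List Y) :
    listRel r xs ys ≤ listRel s (xs.map f) (ys.map g) := by
  induction xs generalizing ys with
  | nil => cases ys <;> simp [listRel]
  | cons x xs ih =>
    cases ys with
    | nil => simp [listRel]
    | cons y ys => exact mul_le_mul' (h x y) (ih ys)

/-- A weight lies below a presheaf `t`, up to `v`, exactly when the presheaf it generates does. -/
theorem presheafGen_le_iff {X : LVCat V} {w t : List X.carrier → V} {v : V}
    (ht : ∀ xss ys, listRel X.hom xss ys * t ys ≤ t xss.flatten) :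
    (∀ xs, v * (presheafGen X w).val xs ≤ t xs) ↔ ∀ xs, v * w xs ≤ t xs := by
  constructor
  · exact fun h xs => (mul_le_mul_right (le_presheafGen X w xs) v).trans (h xs)
  · intro h
    suffices h' : bullet (fun xs (_ : PUnit.{u + 1}) => w xs) X.hom ≤
        fun xs _ => Quantale.leftMulResiduation v (t xs) from fun xs => by
      rw [mul_comm, ← Quantale.leftMulResiduation_le_iff_mul_le]
      exact h' xs PUnit.unit
    refine bullet_le_iff.2 fun xss ys _ => ?_
    rw [Quantale.leftMulResiduation_le_iff_mul_le, mul_assoc, mul_comm (w ys)]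
    exact (mul_le_mul_right (h ys) _).trans (ht xss ys)

/-- Cocontinuity is stated for weights that are presheaves; it extends to all weights. -/
theorem map_lvSup {X Y : Inj V} (f : X ⟶ Y) (w : List X.carrier → V) :
    f.toFun (lvSup X w) = lvSup Y (pmap (List.map f.toFun) w) := by
  have h := f.isCocontinuous _ _ X.isCocomplete.choose_spec Y.isCocomplete.choose_spec
    (presheafGen X.toLVCat w)
  have e : f.toFun (lvSup X w) = _ := Y.isSeparated.eq h.1 h.2
  rw [e]
  refine eq_lvSup fun v y => ?_
  refine (Y.isCocomplete.choose_spec.le_hom_presheafMap_iff f.toLVFunctor).trans ?_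
  refine (presheafGen_le_iff fun xss ys => ?_).trans
    (mul_pmap_le_iff (f := List.map f.toFun) (t := fun ys => Y.hom ys y)).symm
  rw [List.map_flatten]
  exact (mul_le_mul_left (listRel_le_listRel_map f.hom_le xss ys) _).trans (Y.hom_comp _ _ _)

theorem map_lvProd {X Y : Inj V} (f : X ⟶ Y) (xs : List X.carrier) :
    f.toFun (lvProd X xs) = lvProd Y (xs.map f.toFun) := by
  rw [lvProd, map_lvSup, pmap_diag]
  rfl

theorem map_lvAct {X Y : Inj V} (f : X ⟶ Y) (φ : X.carrier → V) :
    f.toFun (lvAct X φ) = lvAct Y (pmap f.toFun φ) := by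
  rw [lvAct, map_lvSup, pmap_pmap, lvAct, pmap_pmap]
  rfl

/-- The supremum of a weight on points is the value of the structure map that `M` comes with. -/
theorem lvAct_monInj (M : Mon (PowAlg V)) (φ : M.X.A → V) :
    lvAct (monInj M) φ = act M.X φ :=
  (monLV_isSeparated M).eq_of_hom fun v y => by
    refine (le_hom_lvAct_iff (X := monInj M)).trans ?_
    rw [act_eq_wsum]
    have h := (le_monLV_hom_wsum_iff M (Φ := φ) (g := fun x => [x]) (y := y) (v := v)).symm
    simp only [List.prod_singleton] at h
    exact h

theorem lvProd_monInj (M : Mon (PowAlg V)) (xs : List M.X.A) :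
    lvProd (monInj M) xs = xs.prod :=
  (monLV_isSeparated M).eq_of_hom fun v y => iff_of_eq <| congrArg (v ≤ ·) <|
    (hom_lvProd (monInj M) xs y).trans (monLV_hom_singleton M _ y).symm

/-! ### The equivalence -/

instance : (monToInj V).Faithful where
  map_injective {M N _ _} h := Mon.Hom.ext' <| alg_hom_ext fun x =>
    congrArg (fun k : InjHom (monInj M) (monInj N) => k.toFun x) h

theorem map_prod_of_injHom {M N : Mon (PowAlg V)} (f : monInj M ⟶ monInj N) (xs : List M.X.A) :
    f.toFun xs.prod = List.prod (α := N.X.A) (xs.map f.toFun) := by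
  rw [← lvProd_monInj N, ← lvProd_monInj M]
  exact map_lvProd f xs

theorem unitAlg_hom_ext {A : PowAlg V} {g g' : unitAlg V ⟶ A}
    (h : g.f (unitPt V) = g'.f (unitPt V)) : g = g' :=
  alg_hom_ext fun v => by
    rw [← smulAlg_unit v, (isHomFun_of_hom g).smulAlg, (isHomFun_of_hom g').smulAlg, h]

/-- A cocontinuous functor between the `(L,V)`-categories of monoids is a morphism of monoids. -/
def monHomOfInjHom {M N : Mon (PowAlg V)} (f : monInj M ⟶ monInj N) : M ⟶ N where
  hom := mkHom (A := M.X) (B := N.X) f.toFun fun φ => by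
    rw [← lvAct_monInj, ← lvAct_monInj]
    exact map_lvAct f φ
  isMonHom_hom :=
    { one_hom := unitAlg_hom_ext (map_prod_of_injHom f [])
      mul_hom := tensor_ext fun x y => by
        change f.toFun (x * y : M.X.A) = (MonObj.mul (X := N.X)).f ((tensorMap _ _).f (tmul x y))
        rw [tensorMap_tmul]
        have h := map_prod_of_injHom f [x, y]
        rw [List.prod_cons, List.prod_singleton] at h
        exact h.trans ((List.prod_cons (α := N.X.A)).trans
          (congrArg (HMul.hMul (α := N.X.A) (f.toFun x)) (List.prod_singleton (α := N.X.A)))) }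

instance : (monToInj V).Full where
  map_surjective f := ⟨monHomOfInjHom f, rfl⟩

instance : (monToInj V).EssSurj where
  mem_essImage X := ⟨lvMon X, ⟨eqToIso (monInj_lvMon X)⟩⟩

instance : (monToInj V).IsEquivalence where

end

end QuantMulti

theorem mainTheorem2 (V : Type u) [CommMonoid V] [CompleteLattice V] [IsQuantale V] :
    ∃ E : Mon (QuantMulti.PowAlg V) ≌ QuantMulti.Inj V,
      Nonempty (E.functor ⋙ QuantMulti.injForget V ≅ QuantMulti.monForget V) :=
  ⟨(QuantMulti.monToInj V).asEquivalence, ⟨Iso.refl _⟩⟩
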